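/- Let $A_1$ and $C$ be unital $C^*$-algebras, each containing $D=\mathbb{C}p\oplus\mathbb{C}q\cong\mathbb{C}^2$ as a unital $C^*$-subalgebra ($p,q$ the minimal projections of $D$), with conditional expectations $E_1:A_1\to D$, $E_2:C\to D$ and faithful positive (not necessarily normalised) traces $\mathrm{tr}_1$ on $A_1$, $\mathrm{tr}_2$ on $C$, such that $\mathrm{tr}_i\circ E_i=\mathrm{tr}_i$ for $i=1,2$ and $\mathrm{tr}_1|_D=\mathrm{tr}_2|_D$. Suppose that $q=r+r'$ for orthogonal projections $r,r'\in A_1$ and that $A_1=B\oplus\mathbb{C}r'$, i.e. $r'$ is central in $A_1$, $A_1r'=\mathbb{C}r'$, and $B=(p+r)A_1(p+r)$, with unit $p+r$ (the degenerate cases $r=0$ and $r'=0$ are allowed). For unital $C^*$-algebras $A_1,A_2\supseteq D$ with conditional expectations $E_i$ onto $D$, the reduced amalgamated free product $(A_1,E_1)*_D(A_2,E_2)$ is the $C^*$-algebra $F$, unique up to canonical isomorphism, with a conditional expectation $E:F\to D$ and unital inclusions of $A_1$ and $A_2$ that agree on $D$, such that $E$ extends $E_1$ and $E_2$, $A_1\cup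 A_2$ generates $F$ as a $C^*$-algebra, $E(x_1\cdots x_n)=0$ for every nonempty alternating word in $\ker E_1$ and $\ker E_2$, and the GNS representation of $E$ is faithful. Let $$(A,E)=(B\oplus\mathbb{C}r',E_1)*_D(C,E_2),\qquad (C',E')=\bigl(\mathbb{C}p\oplus\mathbb{C}r\oplus\mathbb{C}r',E_1|\bigr)*_D(C,E_2),$$ equipped with the functionals $\mathrm{tr}_1\circ E$ and $\mathrm{tr}_1\circ E'$, and let $D'=\mathbb{C}p\oplus\mathbb{C}r$, which is a unital $C^*$-subalgebra of both $B$ and $(p+r)C'(p+r)$. Then there are unique trace preserving conditional expectations $E_1^{D'}:B\to D'$ and $E_2^{D'}:(p+r)C'(p+r)\to D'$; there is a $*$-homomorphism $\kappa:C'\to A$ that extends the inclusions of $\mathbb{C}p\oplus\mathbb{C}r\oplus\mathbb{C}r'$ and of $C$ in $A$ and satisfies $E\circ\kappa=E'$; and, with the inclusions of $B$ and (through $\kappa$) of $(p+r)C'(p+r)$, $$(p+r)A(p+r)=\bigl(B,E_1^{D'}\bigr)*_{D'}\bigl((p+r)C'(p+r),E_2^{D'}\bigr),$$ as a reduced amalgamated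 free product whose conditional expectation $(p+r)A(p+r)\to D'$ preserves the trace $\mathrm{tr}_1\circ E$. -/

import Mathlib

open scoped ComplexOrder

/-! ### Traces and conditional expectations -/

/-- A (not necessarily normalised) faithful positive trace on a `C⋆`-algebra. -/
structure IsFaithfulTrace {A : Type*} [CStarAlgebra A] (τ : A →ₗ[ℂ] ℂ) : Prop where
  nonneg : ∀ a, 0 ≤ τ (star a * a)
  mul_comm : ∀ a b, τ (a * b) = τ (b * a)
  faithful : ∀ a, τ (star a * a) = 0 → a = 0

/-- `E` is a conditional expectation of `A` onto the unital `C⋆`-subalgebra `d(D)`, where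
`d : D → A` is the inclusion of `D` in `A`: a positive `D`-bimodule map which restricts to the
identity on `D`. (Elements of the form `star b * b` are the positive elements of `D`.) -/
structure IsCondExp {D A : Type*} [CStarAlgebra D] [CStarAlgebra A]
    (d : D →⋆ₐ[ℂ] A) (E : A →ₗ[ℂ] D) : Prop where
  apply_inclusion : ∀ x, E (d x) = x
  bimodule : ∀ x a y, E (d x * a * d y) = x * E a * y
  positive : ∀ a, ∃ b, E (star a * a) = star b * b

/-! ### Reduced amalgamated free products -/

/-- `(F, E)` together with the inclusions `ι₁ : A₁ → F` and `ι₂ : A₂ → F` is the reduced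
amalgamated free product `(A₁, E₁) *_D (A₂, E₂)`, where `D` is contained in `Aᵢ` through `dᵢ`.
This is the usual (Voiculescu) definition of the reduced amalgamated free product, which
determines `(F, E, ι₁, ι₂)` up to a unique isomorphism:
the inclusions agree on `D`; `E` is a conditional expectation onto `D` extending `E₁` and `E₂`;
`F` is generated by the two algebras as a `C⋆`-algebra; the two algebras are free with
amalgamation over `D` with respect to `E`; and the GNS representation of `F` associated with `E`
is faithful (this is what *reduced* means). -/
structure IsReducedAmalgFreeProd {D A₁ A₂ F : Type*}
    [CStarAlgebra D] [CStarAlgebra A₁] [CStarAlgebra A₂] [CStarAlgebra F]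
    (d₁ : D →⋆ₐ[ℂ] A₁) (E₁ : A₁ →ₗ[ℂ] D) (d₂ : D →⋆ₐ[ℂ] A₂) (E₂ : A₂ →ₗ[ℂ] D)
    (ι₁ : A₁ →⋆ₐ[ℂ] F) (ι₂ : A₂ →⋆ₐ[ℂ] F) (E : F →ₗ[ℂ] D) : Prop where
  injective₁ : Function.Injective ι₁
  injective₂ : Function.Injective ι₂
  amalgamated : ∀ x, ι₁ (d₁ x) = ι₂ (d₂ x)
  condExp : IsCondExp (ι₁.comp d₁) E
  extends₁ : ∀ a, E (ι₁ a) = E₁ a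
  extends₂ : ∀ a, E (ι₂ a) = E₂ a
  generates :
    (StarAlgebra.adjoin ℂ (Set.range ι₁ ∪ Set.range ι₂)).topologicalClosure = ⊤
  /-- Every nonempty alternating word in elements of `A₁` and `A₂` with zero expectation has
  zero expectation. -/
  free : ∀ w : List (A₁ ⊕ A₂), w ≠ [] →
    w.IsChain (fun x y => x.isLeft ≠ y.isLeft) →
    (∀ x ∈ w, Sum.elim E₁ E₂ x = 0) →
    E (w.map (Sum.elim ι₁ ι₂)).prod = 0
  /-- An element which acts as zero in the GNS representation of `E` is zero. -/
  gns_faithful : ∀ a, (∀ x, E (star (a * x) * (a * x)) = 0) → a = 0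

/-! ### Corners -/

/-- The corner `eAe` of a `C⋆`-algebra `A` at a projection `e`, as a subalgebra of `A`. -/
def cornerSubalgebra {A : Type*} [CStarAlgebra A] {e : A} (he : IsStarProjection e) :
    NonUnitalStarSubalgebra ℂ A where
  carrier := {x | e * x = x ∧ x * e = x}
  zero_mem' := by simp
  add_mem' := by
    rintro a b ⟨ha, ha'⟩ ⟨hb, hb'⟩
    exact ⟨by rw [mul_add, ha, hb], by rw [add_mul, ha', hb']⟩
  mul_mem' := by
    rintro a b ⟨ha, _⟩ ⟨_, hb'⟩
    exact ⟨by rw [← mul_assoc, ha], by rw [mul_assoc, hb']⟩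
  smul_mem' := by
    rintro c a ⟨ha, ha'⟩
    exact ⟨by rw [mul_smul_comm, ha], by rw [smul_mul_assoc, ha']⟩
  star_mem' := by
    rintro a ⟨ha, ha'⟩
    have h : star e = e := he.isSelfAdjoint
    refine ⟨?_, ?_⟩
    · have := congrArg star ha'
      rwa [star_mul, h] at this
    · have := congrArg star ha
      rwa [star_mul, h] at this

theorem isClosed_cornerSubalgebra {A : Type*} [CStarAlgebra A] {e : A}
    (he : IsStarProjection e) : IsClosed (cornerSubalgebra he : Set A) := by
  have h : (cornerSubalgebra he : Set A) = {x | e * x = x} ∩ {x | x * e = x} := rfl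
  rw [h]
  exact (isClosed_eq (by fun_prop) (by fun_prop)).inter
    (isClosed_eq (by fun_prop) (by fun_prop))

/-- The corner `eAe` as a unital `C⋆`-algebra in its own right, with unit `e`. -/
def Corner {A : Type*} [CStarAlgebra A] {e : A} (he : IsStarProjection e) : Type _ :=
  cornerSubalgebra he

namespace Corner

variable {A B : Type*} [CStarAlgebra A] [CStarAlgebra B]

/-- The non-unital structure that `eAe` inherits from `A`. -/
noncomputable abbrev nonUnitalCStarAlgebra {e : A} (he : IsStarProjection e) :
    NonUnitalCStarAlgebra (Corner he) :=
  NonUnitalStarSubalgebra.nonUnitalCStarAlgebra (cornerSubalgebra he)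
    (h_closed := isClosed_cornerSubalgebra he)

noncomputable instance {e : A} (he : IsStarProjection e) : CStarAlgebra (Corner he) :=
  letI := nonUnitalCStarAlgebra he
  letI nr : NormedRing (Corner he) :=
    { (inferInstance : NonUnitalNormedRing (Corner he)) with
      one := ⟨e, he.isIdempotentElem, he.isIdempotentElem⟩
      one_mul := fun x => Subtype.ext x.2.1
      mul_one := fun x => Subtype.ext x.2.2 }
  { nr, (inferInstance : StarRing (Corner he)), (inferInstance : CompleteSpace (Corner he)),
    (inferInstance : StarModule ℂ (Corner he)),
    Algebra.ofModule (R := ℂ) (A := Corner he) smul_mul_assoc mul_smul_comm with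
    norm_mul_self_le := fun x => CStarRing.norm_mul_self_le x
    norm_smul_le := norm_smul_le }

/-- The inclusion `eAe ⊆ A`. -/
noncomputable def incl {e : A} (he : IsStarProjection e) : Corner he →ₗ[ℂ] A where
  toFun x := x.1
  map_add' _ _ := rfl
  map_smul' _ _ := rfl

/-- The restriction `eAe → fBf` of a `⋆`-homomorphism `φ : A → B` with `φ e = f`. -/
noncomputable def map {e : A} {f : B} (he : IsStarProjection e) (hf : IsStarProjection f)
    (φ : A →⋆ₐ[ℂ] B) (h : φ e = f) : Corner he →⋆ₐ[ℂ] Corner hf where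
  toFun x := ⟨φ x.1, by rw [← h, ← map_mul, x.2.1], by rw [← h, ← map_mul, x.2.2]⟩
  map_one' := Subtype.ext h
  map_mul' x y := Subtype.ext (map_mul φ x.1 y.1)
  map_zero' := Subtype.ext (map_zero φ)
  map_add' x y := Subtype.ext (map_add φ x.1 y.1)
  commutes' c := by
    refine Subtype.ext ?_
    change φ (c • e) = c • f
    rw [map_smul, h]
  map_star' x := Subtype.ext (map_star φ x.1)

end Corner

/-! ### The subalgebra `ℂp ⊕ ℂr ⊕ ℂr'` -/

/-- `p, r, s` are pairwise orthogonal projections with sum `1` (some of them may vanish). -/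
structure IsProjTriple {A : Type*} [CStarAlgebra A] (p r s : A) : Prop where
  proj_p : IsStarProjection p
  proj_r : IsStarProjection r
  proj_s : IsStarProjection s
  mul_pr : p * r = 0
  mul_ps : p * s = 0
  mul_rs : r * s = 0
  sum_eq_one : p + r + s = 1

namespace IsProjTriple

variable {A : Type*} [CStarAlgebra A] {p r s : A}

theorem mul_rp (h : IsProjTriple p r s) : r * p = 0 := by
  have := congrArg star h.mul_pr
  rwa [star_mul, h.proj_p.isSelfAdjoint.star_eq, h.proj_r.isSelfAdjoint.star_eq,
    star_zero] at this

theorem mul_sp (h : IsProjTriple p r s) : s * p = 0 := by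
  have := congrArg star h.mul_ps
  rwa [star_mul, h.proj_p.isSelfAdjoint.star_eq, h.proj_s.isSelfAdjoint.star_eq,
    star_zero] at this

theorem mul_sr (h : IsProjTriple p r s) : s * r = 0 := by
  have := congrArg star h.mul_rs
  rwa [star_mul, h.proj_r.isSelfAdjoint.star_eq, h.proj_s.isSelfAdjoint.star_eq,
    star_zero] at this

theorem mul_comb (h : IsProjTriple p r s) (a b c a' b' c' : ℂ) :
    (a • p + b • r + c • s) * (a' • p + b' • r + c' • s) =
      (a * a') • p + (b * b') • r + (c * c') • s := by
  have hp : p * p = p := h.proj_p.isIdempotentElem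
  have hr : r * r = r := h.proj_r.isIdempotentElem
  have hs : s * s = s := h.proj_s.isIdempotentElem
  simp only [add_mul, mul_add, smul_mul_smul_comm, hp, hr, hs, h.mul_pr, h.mul_ps, h.mul_rs,
    h.mul_rp, h.mul_sp, h.mul_sr, smul_zero, add_zero, zero_add]

/-- The projection `p + r`. -/
theorem proj_add (h : IsProjTriple p r s) : IsStarProjection (p + r) where
  isIdempotentElem := by
    have := h.mul_comb 1 1 0 1 1 0
    simpa [IsIdempotentElem] using this
  isSelfAdjoint := h.proj_p.isSelfAdjoint.add h.proj_r.isSelfAdjoint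

/-- The unital `⋆`-subalgebra `ℂp ⊕ ℂr ⊕ ℂs` of `A`. -/
def alg (h : IsProjTriple p r s) : StarSubalgebra ℂ A where
  carrier := {x | ∃ a b c : ℂ, x = a • p + b • r + c • s}
  mul_mem' := by
    rintro _ _ ⟨a, b, c, rfl⟩ ⟨a', b', c', rfl⟩
    exact ⟨_, _, _, h.mul_comb a b c a' b' c'⟩
  add_mem' := by
    rintro _ _ ⟨a, b, c, rfl⟩ ⟨a', b', c', rfl⟩
    exact ⟨a + a', b + b', c + c', by simp only [add_smul]; abel⟩
  algebraMap_mem' := fun z =>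
    ⟨z, z, z, by rw [← smul_add, ← smul_add, h.sum_eq_one, Algebra.algebraMap_eq_smul_one]⟩
  star_mem' := by
    rintro _ ⟨a, b, c, rfl⟩
    refine ⟨star a, star b, star c, ?_⟩
    simp only [star_add, star_smul, h.proj_p.isSelfAdjoint.star_eq,
      h.proj_r.isSelfAdjoint.star_eq, h.proj_s.isSelfAdjoint.star_eq]

instance isClosed_alg (h : IsProjTriple p r s) : IsClosed (h.alg : Set A) := by
  have : (h.alg : Set A) = (Submodule.span ℂ {p, r, s} : Submodule ℂ A) := by
    ext x
    rw [SetLike.mem_coe, SetLike.mem_coe, Submodule.mem_span_triple]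
    exact ⟨fun ⟨a, b, c, hx⟩ => ⟨a, b, c, hx.symm⟩, fun ⟨a, b, c, hx⟩ => ⟨a, b, c, hx.symm⟩⟩
  rw [this]
  have : FiniteDimensional ℂ (Submodule.span ℂ {p, r, s} : Submodule ℂ A) :=
    FiniteDimensional.span_of_finite ℂ (Set.toFinite _)
  exact Submodule.closed_of_finiteDimensional _

/-- `p + r` as an element of `ℂp ⊕ ℂr ⊕ ℂs`. -/
def unitPR (h : IsProjTriple p r s) : h.alg := ⟨p + r, 1, 1, 0, by simp⟩

theorem proj_unitPR (h : IsProjTriple p r s) : IsStarProjection h.unitPR where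
  isIdempotentElem := Subtype.ext h.proj_add.isIdempotentElem
  isSelfAdjoint := Subtype.ext h.proj_add.isSelfAdjoint

/-- The inclusion of `D = ℂ ⊕ ℂ` in `ℂp ⊕ ℂr ⊕ ℂs`, when `D` is contained in `A` through `d`
with minimal projections `p` and `q = r + s`. -/
noncomputable def inclD (h : IsProjTriple p r s) (d : ℂ × ℂ →⋆ₐ[ℂ] A) (hp : d (1, 0) = p)
    (hq : d (0, 1) = r + s) : ℂ × ℂ →⋆ₐ[ℂ] h.alg :=
  d.codRestrict h.alg fun x => ⟨x.1, x.2, x.2, by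
    have hx : x = x.1 • ((1, 0) : ℂ × ℂ) + x.2 • ((0, 1) : ℂ × ℂ) := by
      ext <;> simp
    rw [add_assoc, ← smul_add, ← hp, ← hq, ← map_smul, ← map_smul, ← map_add, ← hx]⟩

end IsProjTriple

/-! ### Conditional expectations are continuous -/

/-! Write R for the image of A₁ in A, T for the image of ℂp ⊕ ℂr ⊕ ℂr', and W for the span of the
alternating words in ker E₁ and ker E₂ that begin and end in ker E₂ (`oddWords`). The space R + RWR
is dense in A (`mem_topologicalClosure_reducedWords`) and E vanishes on RWR
(`IsReducedAmalgFreeProd.apply_eq_zero`). From this tr₁ ∘ E is a faithful trace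
(`IsReducedAmalgFreeProd.isFaithfulTrace`), so E is faithful. Faithfulness yields κ
(`IsReducedAmalgFreeProd.exists_starAlgHom`) and the GNS condition for the corner.

The expectation of a corner onto D' is E with its second coordinate divided by that of E₁(r)
(`exists_corner_condExp`). It vanishes wherever E does, so freeness over D' reduces to a statement
about E.

Freeness rests on two facts. A letter from B centred over D' lies in ker E₁, and such letters are
stable under multiplication by T, because r' annihilates the corner and T acts there through D'. A
centred letter from the corner of C' is a limit of elements of TWT (`mem_closure_words`): the part
of a reduced word lying in T compresses into D', where subtracting the expectation removes it. In an
alternating product a B-letter between two such letters contributes TBT ⊆ B ⊆ ker E₁, so the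
neighbouring words fuse by WBW ⊆ W. The product therefore lies in the closure of B + RWR, on which E
is zero (`alternating_prod_mem`).

The corner is generated as required because A₁ = B + ℂr' and r' already comes from C'
(`Corner.generates`). -/

theorem IsCondExp.continuous {D A : Type*} [CStarAlgebra D] [CStarAlgebra A]
    {d : D →⋆ₐ[ℂ] A} {E : A →ₗ[ℂ] D} (hE : IsCondExp d E) : Continuous E := by
  let _ := CStarAlgebra.spectralOrder A
  let _ := CStarAlgebra.spectralOrderedRing A
  let _ := CStarAlgebra.spectralOrder D
  let _ := CStarAlgebra.spectralOrderedRing D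
  -- Positive linear maps between C⋆-algebras are bounded; the spectral orders serve only to apply
  -- this.
  let f : A →ₚ[ℂ] D := PositiveLinearMap.mk₀ E fun a ha => by
    obtain ⟨b, rfl⟩ := CStarAlgebra.nonneg_iff_eq_star_mul_self.1 ha
    obtain ⟨c, hc⟩ := hE.positive b
    rw [hc]
    exact star_mul_self_nonneg c
  obtain ⟨C, hC⟩ := f.exists_norm_apply_le
  exact (E.mkContinuous C hC).continuous

theorem IsCondExp.map_mul_right {D A : Type*} [CStarAlgebra D] [CStarAlgebra A]
    {d : D →⋆ₐ[ℂ] A} {E : A →ₗ[ℂ] D} (hE : IsCondExp d E) (a : A) (x : D) :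
    E (a * d x) = E a * x := by
  simpa using hE.bimodule 1 a x

theorem IsCondExp.map_mul_left {D A : Type*} [CStarAlgebra D] [CStarAlgebra A]
    {d : D →⋆ₐ[ℂ] A} {E : A →ₗ[ℂ] D} (hE : IsCondExp d E) (x : D) (a : A) :
    E (d x * a) = x * E a := by
  simpa using hE.bimodule x a 1

/-! ### Ranges and centred elements as submodules -/

section Submodules

variable {D A F : Type*} [CStarAlgebra D] [CStarAlgebra A] [CStarAlgebra F]

/-- The range of a `⋆`-homomorphism, as a submodule. -/
noncomputable def imageSubmodule (f : A →⋆ₐ[ℂ] F) : Submodule ℂ F :=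
  LinearMap.range f.toAlgHom.toLinearMap

/-- The image of the kernel of `E`, as a submodule. -/
noncomputable def centredSubmodule (f : A →⋆ₐ[ℂ] F) (E : A →ₗ[ℂ] D) : Submodule ℂ F :=
  (LinearMap.ker E).map f.toAlgHom.toLinearMap

theorem one_le_imageSubmodule (f : A →⋆ₐ[ℂ] F) : 1 ≤ imageSubmodule f :=
  Submodule.one_le.2 ⟨1, map_one f⟩

theorem imageSubmodule_mul_self_le (f : A →⋆ₐ[ℂ] F) :
    imageSubmodule f * imageSubmodule f ≤ imageSubmodule f := by
  rw [Submodule.mul_le]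
  rintro _ ⟨a, rfl⟩ _ ⟨b, rfl⟩
  exact ⟨a * b, map_mul f a b⟩

theorem centredSubmodule_le_imageSubmodule (f : A →⋆ₐ[ℂ] F) (E : A →ₗ[ℂ] D) :
    centredSubmodule f E ≤ imageSubmodule f := by
  rintro _ ⟨a, -, rfl⟩
  exact ⟨a, rfl⟩

theorem imageSubmodule_comp_le (f : A →⋆ₐ[ℂ] F) (d : D →⋆ₐ[ℂ] A) :
    imageSubmodule (f.comp d) ≤ imageSubmodule f := by
  rintro _ ⟨a, rfl⟩
  exact ⟨d a, rfl⟩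

variable {d : D →⋆ₐ[ℂ] A} {E : A →ₗ[ℂ] D}

theorem IsCondExp.imageSubmodule_le (hE : IsCondExp d E) (f : A →⋆ₐ[ℂ] F) :
    imageSubmodule f ≤ imageSubmodule (f.comp d) ⊔ centredSubmodule f E := by
  rintro _ ⟨a, rfl⟩
  refine Submodule.mem_sup.2 ⟨f (d (E a)), ⟨E a, rfl⟩, f (a - d (E a)),
    ⟨_, ?_, rfl⟩, ?_⟩
  · simp [hE.apply_inclusion]
  · simp

theorem IsCondExp.centredSubmodule_mul_le (hE : IsCondExp d E) (f : A →⋆ₐ[ℂ] F) :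
    centredSubmodule f E * imageSubmodule (f.comp d) ≤ centredSubmodule f E := by
  rw [Submodule.mul_le]
  rintro _ ⟨a, ha, rfl⟩ _ ⟨x, rfl⟩
  refine ⟨a * d x, ?_, map_mul f _ _⟩
  rw [SetLike.mem_coe, LinearMap.mem_ker] at ha ⊢
  rw [hE.map_mul_right, ha, zero_mul]

end Submodules

/-! ### The span of the reduced words -/

section Words

variable {D A₁ A₂ F : Type*} [CStarAlgebra D] [CStarAlgebra A₁] [CStarAlgebra A₂]
  [CStarAlgebra F]

/-- The span of the alternating words which begin and end in the kernel of `E₂`. -/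
noncomputable def oddWords (ι₁ : A₁ →⋆ₐ[ℂ] F) (E₁ : A₁ →ₗ[ℂ] D) (ι₂ : A₂ →⋆ₐ[ℂ] F) (E₂ : A₂ →ₗ[ℂ] D) :
    Submodule ℂ F :=
  ⨆ n : ℕ, (centredSubmodule ι₂ E₂ * centredSubmodule ι₁ E₁) ^ n * centredSubmodule ι₂ E₂

variable {ι₁ : A₁ →⋆ₐ[ℂ] F} {E₁ : A₁ →ₗ[ℂ] D} {ι₂ : A₂ →⋆ₐ[ℂ] F} {E₂ : A₂ →ₗ[ℂ] D}

theorem centredSubmodule_le_oddWords : centredSubmodule ι₂ E₂ ≤ oddWords ι₁ E₁ ι₂ E₂ :=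
  le_iSup_of_le 0 (by simp)

/-- Two odd words joined by one centred letter of the first algebra alternate again. This is the
fusion behind freeness in the corner. -/
theorem oddWords_mul_centred_mul_oddWords_le :
    oddWords ι₁ E₁ ι₂ E₂ * centredSubmodule ι₁ E₁ * oddWords ι₁ E₁ ι₂ E₂ ≤
      oddWords ι₁ E₁ ι₂ E₂ := by
  conv_lhs => rw [oddWords, Submodule.iSup_mul, Submodule.iSup_mul]
  refine iSup_le fun m => ?_
  rw [Submodule.mul_iSup]
  refine iSup_le fun n => le_iSup_of_le (m + 1 + n) (le_of_eq ?_)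
  rw [pow_add, pow_succ]
  simp only [mul_assoc]

/-- The elements of the first algebra, together with the words containing an element of the
second algebra. -/
noncomputable def reducedWords (ι₁ : A₁ →⋆ₐ[ℂ] F) (E₁ : A₁ →ₗ[ℂ] D) (ι₂ : A₂ →⋆ₐ[ℂ] F) (E₂ : A₂ →ₗ[ℂ] D) :
    Submodule ℂ F :=
  imageSubmodule ι₁ ⊔ imageSubmodule ι₁ * oddWords ι₁ E₁ ι₂ E₂ * imageSubmodule ι₁

theorem imageSubmodule_mul_reducedWords_le₁ :
    imageSubmodule ι₁ * reducedWords ι₁ E₁ ι₂ E₂ ≤ reducedWords ι₁ E₁ ι₂ E₂ := by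
  rw [reducedWords, Submodule.mul_sup, ← mul_assoc, ← mul_assoc]
  have := imageSubmodule_mul_self_le ι₁
  gcongr

theorem oddWords_le_reducedWords_mul :
    oddWords ι₁ E₁ ι₂ E₂ * imageSubmodule ι₁ ≤ reducedWords ι₁ E₁ ι₂ E₂ := by
  refine le_sup_of_le_right ?_
  rw [mul_assoc]
  exact le_mul_of_one_le_left' (one_le_imageSubmodule ι₁)

theorem reducedWords_mul_le :
    reducedWords ι₁ E₁ ι₂ E₂ * imageSubmodule ι₁ ≤ reducedWords ι₁ E₁ ι₂ E₂ := by
  rw [reducedWords, Submodule.sup_mul, mul_assoc _ (imageSubmodule ι₁)]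
  have := imageSubmodule_mul_self_le ι₁
  gcongr

variable {d₁ : D →⋆ₐ[ℂ] A₁} {d₂ : D →⋆ₐ[ℂ] A₂}

/-- Where two letters of the second algebra meet, their product is its expectation plus a centred
letter. The expectation merges with the next letter of the first algebra; as outer factors in
`reducedWords` need not be centred, the reduction stops there and no induction is needed. -/
theorem centred_mul_oddWords_le (hE₂ : IsCondExp d₂ E₂) (h : ∀ x, ι₁ (d₁ x) = ι₂ (d₂ x)) :
    centredSubmodule ι₂ E₂ * oddWords ι₁ E₁ ι₂ E₂ ≤ reducedWords ι₁ E₁ ι₂ E₂ := by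
  have hd : ι₂.comp d₂ = ι₁.comp d₁ := StarAlgHom.ext fun x => (h x).symm
  have hN : centredSubmodule ι₂ E₂ * centredSubmodule ι₂ E₂ ≤
      imageSubmodule ι₁ ⊔ centredSubmodule ι₂ E₂ := by
    have h₁ : centredSubmodule ι₂ E₂ * centredSubmodule ι₂ E₂ ≤ imageSubmodule ι₂ :=
      (mul_le_mul' (centredSubmodule_le_imageSubmodule _ _)
        (centredSubmodule_le_imageSubmodule _ _)).trans (imageSubmodule_mul_self_le ι₂)
    refine (h₁.trans (hE₂.imageSubmodule_le ι₂)).trans ?_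
    rw [hd]
    exact sup_le_sup_right (imageSubmodule_comp_le ι₁ d₁) _
  have hW : oddWords ι₁ E₁ ι₂ E₂ ≤ reducedWords ι₁ E₁ ι₂ E₂ :=
    (le_mul_of_one_le_right' (one_le_imageSubmodule ι₁)).trans oddWords_le_reducedWords_mul
  conv_lhs => rw [oddWords, Submodule.mul_iSup]
  refine iSup_le fun n => ?_
  cases n with
  | zero =>
    rw [pow_zero, one_mul]
    exact hN.trans (sup_le le_sup_left (centredSubmodule_le_oddWords.trans hW))
  | succ n =>
    rw [pow_succ']
    simp only [← mul_assoc]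
    rw [mul_assoc, mul_assoc, ← mul_assoc (centredSubmodule ι₁ E₁)]
    refine (mul_le_mul_left hN _).trans ?_
    rw [Submodule.sup_mul]
    refine sup_le ?_ ?_
    · have h₁ : imageSubmodule ι₁ * centredSubmodule ι₁ E₁ ≤ imageSubmodule ι₁ :=
        (mul_le_mul' le_rfl (centredSubmodule_le_imageSubmodule _ _)).trans
          (imageSubmodule_mul_self_le ι₁)
      rw [mul_assoc, ← mul_assoc (imageSubmodule ι₁)]
      refine (mul_le_mul' h₁ (le_iSup (fun n : ℕ => (centredSubmodule ι₂ E₂ *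
        centredSubmodule ι₁ E₁) ^ n * centredSubmodule ι₂ E₂) n)).trans ?_
      exact (mul_le_mul' le_rfl hW).trans imageSubmodule_mul_reducedWords_le₁
    · refine le_trans ?_ hW
      refine le_iSup_of_le (n + 1) (le_of_eq ?_)
      rw [pow_succ']
      simp only [mul_assoc]

/-- The uncentred factor behind a new centred letter splits into a part in `D`, absorbed by that
letter, and a centred part, which continues the alternation. -/
theorem imageSubmodule_mul_reducedWords_le₂ (hE₁ : IsCondExp d₁ E₁) (hE₂ : IsCondExp d₂ E₂)
    (h : ∀ x, ι₁ (d₁ x) = ι₂ (d₂ x)) :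
    imageSubmodule ι₂ * reducedWords ι₁ E₁ ι₂ E₂ ≤ reducedWords ι₁ E₁ ι₂ E₂ := by
  have hd : ι₂.comp d₂ = ι₁.comp d₁ := StarAlgHom.ext fun x => (h x).symm
  refine (mul_le_mul_left (hE₂.imageSubmodule_le ι₂) _).trans ?_
  rw [Submodule.sup_mul, hd]
  refine sup_le ((mul_le_mul_left (imageSubmodule_comp_le ι₁ d₁) _).trans
    imageSubmodule_mul_reducedWords_le₁) ?_
  conv_lhs => rw [reducedWords, Submodule.mul_sup]
  refine sup_le ((mul_le_mul_left centredSubmodule_le_oddWords _).trans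
    oddWords_le_reducedWords_mul) ?_
  rw [← mul_assoc]
  refine (mul_le_mul_left ?_ _).trans reducedWords_mul_le
  rw [← mul_assoc]
  refine (mul_le_mul_left (mul_le_mul_right (hE₁.imageSubmodule_le ι₁) _) _).trans ?_
  rw [Submodule.mul_sup, Submodule.sup_mul]
  refine sup_le ?_ ?_
  · rw [← hd]
    exact (mul_le_mul_left (hE₂.centredSubmodule_mul_le ι₂) _).trans
      (centred_mul_oddWords_le hE₂ h)
  · refine ((mul_le_mul_left (mul_le_mul_left centredSubmodule_le_oddWords _) _).trans
      oddWords_mul_centred_mul_oddWords_le).trans ?_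
    exact (le_mul_of_one_le_right' (one_le_imageSubmodule ι₁)).trans oddWords_le_reducedWords_mul

/-- A subspace which contains `1` and is invariant under left multiplication by two subalgebras is
dense in the `C⋆`-algebra which they generate. -/
theorem mem_topologicalClosure_of_mul_le (M : Submodule ℂ F) (h1 : 1 ≤ M)
    (hM₁ : imageSubmodule ι₁ * M ≤ M) (hM₂ : imageSubmodule ι₂ * M ≤ M) {x : F}
    (hx : x ∈ (StarAlgebra.adjoin ℂ (Set.range ι₁ ∪ Set.range ι₂)).topologicalClosure) :
    x ∈ M.topologicalClosure := by
  refine closure_mono (fun y hy => ?_) hx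
  have hstar : star (Set.range ι₁ ∪ Set.range ι₂) ⊆ Set.range ι₁ ∪ Set.range ι₂ := by
    rintro y (⟨a, ha⟩ | ⟨a, ha⟩)
    · exact Or.inl ⟨star a, by rw [map_star, ha, star_star]⟩
    · exact Or.inr ⟨star a, by rw [map_star, ha, star_star]⟩
  have hy' : y ∈ Algebra.adjoin ℂ (Set.range ι₁ ∪ Set.range ι₂) := by
    have h : y ∈ (StarAlgebra.adjoin ℂ (Set.range ι₁ ∪ Set.range ι₂)).toSubalgebra := hy
    rwa [StarAlgebra.adjoin_toSubalgebra, Set.union_eq_left.2 hstar] at h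
  suffices ∀ m ∈ M, y * m ∈ M by simpa using this 1 (Submodule.one_le.1 h1)
  clear hy hx
  induction hy' using Algebra.adjoin_induction with
  | mem z hz =>
    intro m hm
    rcases hz with hz | hz
    · exact hM₁ (Submodule.mul_mem_mul hz hm)
    · exact hM₂ (Submodule.mul_mem_mul hz hm)
  | algebraMap c =>
    intro m hm
    rw [← Algebra.smul_def]
    exact M.smul_mem c hm
  | add a b _ _ ha hb =>
    intro m hm
    rw [add_mul]
    exact M.add_mem (ha m hm) (hb m hm)
  | mul a b _ _ ha hb =>
    intro m hm
    rw [mul_assoc]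
    exact ha _ (hb m hm)

/-- Only amalgamation and the two expectations enter, not freeness, so this also applies inside a
product `F × G`, as `exists_starAlgHom` requires. -/
theorem mem_topologicalClosure_reducedWords (hE₁ : IsCondExp d₁ E₁) (hE₂ : IsCondExp d₂ E₂)
    (h : ∀ x, ι₁ (d₁ x) = ι₂ (d₂ x)) {x : F}
    (hx : x ∈ (StarAlgebra.adjoin ℂ (Set.range ι₁ ∪ Set.range ι₂)).topologicalClosure) :
    x ∈ (reducedWords ι₁ E₁ ι₂ E₂).topologicalClosure :=
  mem_topologicalClosure_of_mul_le _ (le_sup_of_le_left (one_le_imageSubmodule ι₁))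
    imageSubmodule_mul_reducedWords_le₁ (imageSubmodule_mul_reducedWords_le₂ hE₁ hE₂ h) hx

end Words

/-! ### Vanishing of the expectation on reduced words -/

section Vanishing

variable {D A₁ A₂ F : Type*} [CStarAlgebra D] [CStarAlgebra A₁] [CStarAlgebra A₂]
  [CStarAlgebra F]

/-- The span of the nonempty alternating words of centred elements whose first letter belongs to
the first algebra (`b = true`) or to the second one (`b = false`). -/
noncomputable def wordsFrom (ι₁ : A₁ →⋆ₐ[ℂ] F) (E₁ : A₁ →ₗ[ℂ] D) (ι₂ : A₂ →⋆ₐ[ℂ] F)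
    (E₂ : A₂ →ₗ[ℂ] D) (b : Bool) : Submodule ℂ F :=
  Submodule.span ℂ {x | ∃ w : List (A₁ ⊕ A₂), w.IsChain (fun x y => x.isLeft ≠ y.isLeft) ∧
    (∀ y ∈ w, Sum.elim E₁ E₂ y = 0) ∧ w.head?.map Sum.isLeft = some b ∧
    (w.map (Sum.elim ι₁ ι₂)).prod = x}

variable {ι₁ : A₁ →⋆ₐ[ℂ] F} {E₁ : A₁ →ₗ[ℂ] D} {ι₂ : A₂ →⋆ₐ[ℂ] F} {E₂ : A₂ →ₗ[ℂ] D}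

theorem mul_mem_wordsFrom {y : A₁ ⊕ A₂} (hy : Sum.elim E₁ E₂ y = 0) {v : F}
    (hv : v ∈ wordsFrom ι₁ E₁ ι₂ E₂ (!y.isLeft)) :
    Sum.elim ι₁ ι₂ y * v ∈ wordsFrom ι₁ E₁ ι₂ E₂ y.isLeft := by
  have h : wordsFrom ι₁ E₁ ι₂ E₂ (!y.isLeft) ≤
      (wordsFrom ι₁ E₁ ι₂ E₂ y.isLeft).comap (LinearMap.mulLeft ℂ (Sum.elim ι₁ ι₂ y)) := by
    refine Submodule.span_le.2 ?_
    rintro _ ⟨w, hw, hw0, hb, rfl⟩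
    refine Submodule.subset_span ⟨y :: w, ?_, ?_, rfl, by simp⟩
    · rw [List.isChain_cons]
      refine ⟨fun z hz => ?_, hw⟩
      rw [Option.mem_def.1 hz, Option.map_some, Option.some_inj] at hb
      rw [hb]
      cases y.isLeft <;> simp
    · simpa [hy] using hw0
  exact h hv

theorem mem_wordsFrom {y : A₁ ⊕ A₂} (hy : Sum.elim E₁ E₂ y = 0) :
    Sum.elim ι₁ ι₂ y ∈ wordsFrom ι₁ E₁ ι₂ E₂ y.isLeft :=
  Submodule.subset_span ⟨[y], List.isChain_singleton _, by simpa using hy, rfl, by simp⟩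

theorem centred_mul_wordsFrom_le₁ : centredSubmodule ι₁ E₁ * wordsFrom ι₁ E₁ ι₂ E₂ false ≤
    wordsFrom ι₁ E₁ ι₂ E₂ true := by
  rw [Submodule.mul_le]
  rintro _ ⟨a, ha, rfl⟩ v hv
  exact mul_mem_wordsFrom (y := .inl a) ha hv

theorem centred_mul_wordsFrom_le₂ : centredSubmodule ι₂ E₂ * wordsFrom ι₁ E₁ ι₂ E₂ true ≤
    wordsFrom ι₁ E₁ ι₂ E₂ false := by
  rw [Submodule.mul_le]
  rintro _ ⟨a, ha, rfl⟩ v hv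
  exact mul_mem_wordsFrom (y := .inr a) ha hv

theorem centred_le_wordsFrom₁ : centredSubmodule ι₁ E₁ ≤ wordsFrom ι₁ E₁ ι₂ E₂ true := by
  rintro _ ⟨a, ha, rfl⟩
  exact mem_wordsFrom (y := .inl a) ha

theorem centred_le_wordsFrom₂ : centredSubmodule ι₂ E₂ ≤ wordsFrom ι₁ E₁ ι₂ E₂ false := by
  rintro _ ⟨a, ha, rfl⟩
  exact mem_wordsFrom (y := .inr a) ha

variable {d₁ : D →⋆ₐ[ℂ] A₁} {d₂ : D →⋆ₐ[ℂ] A₂}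

/-- The `D`-part of the uncentred last factor is absorbed by the preceding letter; its centred part
becomes a new last letter. -/
theorem oddWords_mul_imageSubmodule_le (hE₁ : IsCondExp d₁ E₁) (hE₂ : IsCondExp d₂ E₂)
    (h : ∀ x, ι₁ (d₁ x) = ι₂ (d₂ x)) :
    oddWords ι₁ E₁ ι₂ E₂ * imageSubmodule ι₁ ≤ wordsFrom ι₁ E₁ ι₂ E₂ false := by
  have hd : ι₂.comp d₂ = ι₁.comp d₁ := StarAlgHom.ext fun x => (h x).symm
  rw [oddWords, Submodule.iSup_mul]
  refine iSup_le fun n => ?_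
  induction n with
  | zero =>
    rw [pow_zero, one_mul]
    refine (mul_le_mul_right (hE₁.imageSubmodule_le ι₁) _).trans ?_
    rw [Submodule.mul_sup, ← hd]
    exact sup_le ((hE₂.centredSubmodule_mul_le ι₂).trans centred_le_wordsFrom₂)
      ((mul_le_mul_right centred_le_wordsFrom₁ _).trans centred_mul_wordsFrom_le₂)
  | succ n ih =>
    rw [pow_succ', mul_assoc, mul_assoc, mul_assoc, ← mul_assoc (_ ^ n)]
    exact (mul_le_mul_right ((mul_le_mul_right ih _).trans centred_mul_wordsFrom_le₁) _).trans
      centred_mul_wordsFrom_le₂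

namespace IsReducedAmalgFreeProd

variable {E : F →ₗ[ℂ] D}

theorem apply_wordsFrom (hF : IsReducedAmalgFreeProd d₁ E₁ d₂ E₂ ι₁ ι₂ E) {b : Bool} {x : F}
    (hx : x ∈ wordsFrom ι₁ E₁ ι₂ E₂ b) : E x = 0 := by
  have h : wordsFrom ι₁ E₁ ι₂ E₂ b ≤ LinearMap.ker E := by
    refine Submodule.span_le.2 ?_
    rintro _ ⟨w, hw, hw0, hb, rfl⟩
    refine hF.free w ?_ hw hw0
    rintro rfl
    simp at hb
  exact h hx

/-- The `D`-part of the first factor leaves `E` by the bimodule property; its centred part prolongs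
the word. -/
theorem apply_eq_zero (hF : IsReducedAmalgFreeProd d₁ E₁ d₂ E₂ ι₁ ι₂ E) (hE₁ : IsCondExp d₁ E₁)
    (hE₂ : IsCondExp d₂ E₂) {x : F}
    (hx : x ∈ imageSubmodule ι₁ * oddWords ι₁ E₁ ι₂ E₂ * imageSubmodule ι₁) : E x = 0 := by
  suffices h : imageSubmodule ι₁ * oddWords ι₁ E₁ ι₂ E₂ * imageSubmodule ι₁ ≤ LinearMap.ker E from
    h hx
  rw [mul_assoc]
  refine (mul_le_mul_right (oddWords_mul_imageSubmodule_le hE₁ hE₂ hF.amalgamated) _).trans ?_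
  refine (mul_le_mul_left (hE₁.imageSubmodule_le ι₁) _).trans ?_
  rw [Submodule.sup_mul]
  refine sup_le ?_ fun y hy => hF.apply_wordsFrom (centred_mul_wordsFrom_le₁ hy)
  rw [Submodule.mul_le]
  rintro _ ⟨d, rfl⟩ v hv
  have := hF.condExp.map_mul_left d v
  rw [hF.apply_wordsFrom hv, mul_zero] at this
  exact this

theorem symm (hF : IsReducedAmalgFreeProd d₁ E₁ d₂ E₂ ι₁ ι₂ E) :
    IsReducedAmalgFreeProd d₂ E₂ d₁ E₁ ι₂ ι₁ E where
  injective₁ := hF.injective₂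
  injective₂ := hF.injective₁
  amalgamated x := (hF.amalgamated x).symm
  condExp := by
    have hd : ι₂.comp d₂ = ι₁.comp d₁ := StarAlgHom.ext fun x => (hF.amalgamated x).symm
    exact hd ▸ hF.condExp
  extends₁ := hF.extends₂
  extends₂ := hF.extends₁
  generates := by rw [Set.union_comm, hF.generates]
  free w hw hc h0 := by
    have := hF.free (w.map Sum.swap) (by simpa using hw)
      (by
        rw [List.isChain_map]
        refine hc.imp fun a b hab => ?_
        rcases a with a | a <;> rcases b with b | b <;> simp_all)
      (by
        intro x hx
        obtain ⟨y, hy, rfl⟩ := List.mem_map.1 hx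
        rw [← h0 y hy]
        rcases y with y | y <;> rfl)
    rw [List.map_map] at this
    rw [← this]
    congr 3
    funext y
    rcases y with y | y <;> rfl
  gns_faithful := hF.gns_faithful

theorem mem_closure_reducedWords (hF : IsReducedAmalgFreeProd d₁ E₁ d₂ E₂ ι₁ ι₂ E)
    (hE₁ : IsCondExp d₁ E₁) (hE₂ : IsCondExp d₂ E₂) (x : F) :
    x ∈ (reducedWords ι₁ E₁ ι₂ E₂).topologicalClosure :=
  mem_topologicalClosure_reducedWords hE₁ hE₂ hF.amalgamated (hF.generates ▸ trivial)

/-- On the first algebra this is traciality of `t ∘ E₁`. The words containing a letter of the second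
algebra are stable under multiplication by `ι₁ a` on either side, so both expectations vanish there;
density does the rest. -/
theorem trace_mul_comm_left (hF : IsReducedAmalgFreeProd d₁ E₁ d₂ E₂ ι₁ ι₂ E)
    (hE₁ : IsCondExp d₁ E₁) (hE₂ : IsCondExp d₂ E₂) {t : D →ₗ[ℂ] ℂ} (ht : Continuous t)
    (ht₁ : ∀ a b, t (E₁ (a * b)) = t (E₁ (b * a))) (a : A₁) (x : F) :
    t (E (ι₁ a * x)) = t (E (x * ι₁ a)) := by
  have hEc := hF.condExp.continuous
  let φ : F →ₗ[ℂ] ℂ :=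
    t ∘ₗ E ∘ₗ (LinearMap.mulLeft ℂ (ι₁ a) - LinearMap.mulRight ℂ (ι₁ a))
  have hφ : Continuous φ := by
    refine ht.comp (hEc.comp ?_)
    change Continuous fun x => ι₁ a * x - x * ι₁ a
    fun_prop
  have hle : reducedWords ι₁ E₁ ι₂ E₂ ≤ LinearMap.ker φ := by
    refine sup_le ?_ fun y hy => ?_
    · rintro _ ⟨b, rfl⟩
      change t (E (ι₁ a * ι₁ b - ι₁ b * ι₁ a)) = 0
      rw [← map_mul, ← map_mul, map_sub, map_sub, hF.extends₁, hF.extends₁, ht₁, sub_self]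
    · change t (E (ι₁ a * y - y * ι₁ a)) = 0
      have h := imageSubmodule_mul_self_le ι₁
      have ha : ι₁ a ∈ imageSubmodule ι₁ := ⟨a, rfl⟩
      rw [map_sub, hF.apply_eq_zero hE₁ hE₂, hF.apply_eq_zero hE₁ hE₂, sub_self, map_zero]
      · have := Submodule.mul_mem_mul hy ha
        rw [mul_assoc] at this
        exact mul_le_mul_right h _ this
      · have := Submodule.mul_mem_mul ha hy
        rw [← mul_assoc, ← mul_assoc] at this
        exact mul_le_mul_left (mul_le_mul_left h _) _ this
  have hx := Submodule.topologicalClosure_minimal _ hle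
    (isClosed_singleton.preimage hφ) (hF.mem_closure_reducedWords hE₁ hE₂ x)
  have hx : t (E (ι₁ a * x - x * ι₁ a)) = 0 := hx
  rwa [map_sub, map_sub, sub_eq_zero] at hx

theorem trace_mul_comm (hF : IsReducedAmalgFreeProd d₁ E₁ d₂ E₂ ι₁ ι₂ E)
    (hE₁ : IsCondExp d₁ E₁) (hE₂ : IsCondExp d₂ E₂) {t : D →ₗ[ℂ] ℂ} (ht : Continuous t)
    (ht₁ : ∀ a b, t (E₁ (a * b)) = t (E₁ (b * a)))
    (ht₂ : ∀ a b, t (E₂ (a * b)) = t (E₂ (b * a))) (x y : F) :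
    t (E (x * y)) = t (E (y * x)) := by
  have hEc := hF.condExp.continuous
  -- The elements that commute with everything under the trace form a closed subspace containing `1`
  -- and stable under left multiplication by both algebras, hence all of `F`.
  let M : Submodule ℂ F := LinearMap.ker
    ((LinearMap.mul ℂ F - (LinearMap.mul ℂ F).flip).compr₂ (t ∘ₗ E))
  have hM : ∀ x, x ∈ M ↔ ∀ y, t (E (x * y)) = t (E (y * x)) := by
    intro x
    rw [LinearMap.mem_ker, LinearMap.ext_iff]
    refine forall_congr' fun y => ?_
    change t (E (x * y - y * x)) = 0 ↔ _
    rw [map_sub, map_sub, sub_eq_zero]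
  have hM₁ : imageSubmodule ι₁ * M ≤ M := by
    rw [Submodule.mul_le]
    rintro _ ⟨a, rfl⟩ m hm
    rw [hM] at hm ⊢
    intro y
    have h := hF.trace_mul_comm_left hE₁ hE₂ ht ht₁ a
    change t (E (ι₁ a * m * y)) = t (E (y * (ι₁ a * m)))
    rw [mul_assoc, h, mul_assoc, hm, mul_assoc]
  have hM₂ : imageSubmodule ι₂ * M ≤ M := by
    rw [Submodule.mul_le]
    rintro _ ⟨a, rfl⟩ m hm
    rw [hM] at hm ⊢
    intro y
    have h := hF.symm.trace_mul_comm_left hE₂ hE₁ ht ht₂ a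
    change t (E (ι₂ a * m * y)) = t (E (y * (ι₂ a * m)))
    rw [mul_assoc, h, mul_assoc, hm, mul_assoc]
  have hclosed : IsClosed (M : Set F) := by
    have : (M : Set F) = ⋂ y, {x | t (E (x * y)) = t (E (y * x))} := by
      ext x
      simp [hM]
    rw [this]
    exact isClosed_iInter fun y => isClosed_eq (by fun_prop) (by fun_prop)
  have hx := mem_topologicalClosure_of_mul_le M (Submodule.one_le.2 ((hM 1).2 fun y => by simp))
    hM₁ hM₂ (x := x) (hF.generates ▸ trivial)
  rw [hclosed.submodule_topologicalClosure_eq] at hx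
  exact (hM x).1 hx y

/-- A faithful trace on `D` which is a trace on both algebras gives a faithful trace on their
reduced amalgamated free product. -/
theorem isFaithfulTrace (hF : IsReducedAmalgFreeProd d₁ E₁ d₂ E₂ ι₁ ι₂ E)
    (hE₁ : IsCondExp d₁ E₁) (hE₂ : IsCondExp d₂ E₂) {t : D →ₗ[ℂ] ℂ} (ht : Continuous t)
    (htr : IsFaithfulTrace t) (ht₁ : ∀ a b, t (E₁ (a * b)) = t (E₁ (b * a)))
    (ht₂ : ∀ a b, t (E₂ (a * b)) = t (E₂ (b * a))) : IsFaithfulTrace (t ∘ₗ E) := by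
  have hcomm := hF.trace_mul_comm hE₁ hE₂ ht ht₁ ht₂
  have hpos : ∀ a, 0 ≤ t (E (star a * a)) := fun a => by
    obtain ⟨b, hb⟩ := hF.condExp.positive a
    rw [hb]
    exact htr.nonneg b
  refine ⟨hpos, hcomm, fun a ha => hF.gns_faithful a fun x => ?_⟩
  have ha : t (E (star a * a)) = 0 := ha
  let _ := CStarAlgebra.spectralOrder F
  let _ := CStarAlgebra.spectralOrderedRing F
  let φ : F →ₚ[ℂ] ℂ := PositiveLinearMap.mk₀ (t ∘ₗ E) fun a ha => by
    obtain ⟨b, rfl⟩ := CStarAlgebra.nonneg_iff_eq_star_mul_self.1 ha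
    exact hpos b
  -- Traciality turns `(ax)*(ax)` into `a(xx*)a*`, which is at most `‖xx*‖ aa*`. Thus a trace-null
  -- `a` acts as zero in the GNS representation.
  have h0 : t (E (star (a * x) * (a * x))) = 0 := by
    refine le_antisymm ?_ (hpos _)
    have h : φ (a * (x * star x) * star a) ≤ φ (‖x * star x‖ • (a * star a)) :=
      OrderHomClass.mono φ
        (CStarAlgebra.star_right_conjugate_le_norm_smul (hb := IsSelfAdjoint.mul_star_self x))
    rw [← Complex.coe_smul, map_smul] at h
    have h1 : φ (a * star a) = 0 := (hcomm _ _).trans ha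
    rw [h1, smul_zero] at h
    rw [hcomm, star_mul, ← mul_assoc, mul_assoc a]
    exact h
  obtain ⟨b, hb⟩ := hF.condExp.positive (a * x)
  rw [hb] at h0 ⊢
  rw [htr.faithful b h0, mul_zero]

end IsReducedAmalgFreeProd

end Vanishing

/-! ### Functoriality of the reduced amalgamated free product -/

section Functoriality

variable {D A₀ A₁ A₂ F G : Type*} [CStarAlgebra D] [CStarAlgebra A₀] [CStarAlgebra A₁]
  [CStarAlgebra A₂] [CStarAlgebra F] [CStarAlgebra G]
  {j₁ : A₀ →⋆ₐ[ℂ] F} {E₀ : A₀ →ₗ[ℂ] D} {j₂ : A₂ →⋆ₐ[ℂ] F} {E₂ : A₂ →ₗ[ℂ] D}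
  {ι₁ : A₁ →⋆ₐ[ℂ] G} {E₁ : A₁ →ₗ[ℂ] D} {ι₂ : A₂ →⋆ₐ[ℂ] G}

theorem map_oddWords_le (g : F →⋆ₐ[ℂ] G) (θ : A₀ →⋆ₐ[ℂ] A₁) (hθ : ∀ a, E₁ (θ a) = E₀ a)
    (h₁ : ∀ a, g (j₁ a) = ι₁ (θ a)) (h₂ : ∀ c, g (j₂ c) = ι₂ c) :
    (oddWords j₁ E₀ j₂ E₂).map g.toAlgHom.toLinearMap ≤ oddWords ι₁ E₁ ι₂ E₂ := by
  have hN₁ : (centredSubmodule j₁ E₀).map g.toAlgHom.toLinearMap ≤ centredSubmodule ι₁ E₁ := by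
    rintro _ ⟨_, ⟨a, ha, rfl⟩, rfl⟩
    exact ⟨θ a, (hθ a).trans ha, (h₁ a).symm⟩
  have hN₂ : (centredSubmodule j₂ E₂).map g.toAlgHom.toLinearMap ≤ centredSubmodule ι₂ E₂ := by
    rintro _ ⟨_, ⟨a, ha, rfl⟩, rfl⟩
    exact ⟨a, ha, (h₂ a).symm⟩
  rw [oddWords, Submodule.map_iSup]
  refine iSup_mono fun n => ?_
  rw [Submodule.map_mul, Submodule.map_pow, Submodule.map_mul]
  gcongr

theorem map_imageSubmodule_le (g : F →⋆ₐ[ℂ] G) (θ : A₀ →⋆ₐ[ℂ] A₁)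
    (h₁ : ∀ a, g (j₁ a) = ι₁ (θ a)) :
    (imageSubmodule j₁).map g.toAlgHom.toLinearMap ≤ imageSubmodule ι₁ := by
  rintro _ ⟨_, ⟨a, rfl⟩, rfl⟩
  exact ⟨θ a, (h₁ a).symm⟩

theorem map_mul_oddWords_mul_le (g : F →⋆ₐ[ℂ] G) (θ : A₀ →⋆ₐ[ℂ] A₁)
    (hθ : ∀ a, E₁ (θ a) = E₀ a) (h₁ : ∀ a, g (j₁ a) = ι₁ (θ a)) (h₂ : ∀ c, g (j₂ c) = ι₂ c) :
    (imageSubmodule j₁ * oddWords j₁ E₀ j₂ E₂ * imageSubmodule j₁).map g.toAlgHom.toLinearMap ≤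
      imageSubmodule ι₁ * oddWords ι₁ E₁ ι₂ E₂ * imageSubmodule ι₁ := by
  rw [Submodule.map_mul, Submodule.map_mul]
  have := map_imageSubmodule_le g θ h₁
  have := map_oddWords_le (E₂ := E₂) g θ hθ h₁ h₂
  gcongr

/-- An injective `⋆`-homomorphism is isometric, so its range is closed. -/
theorem StarAlgHom.surjective_of_injective_of_generates {S : Type*} [CStarAlgebra S]
    (φ : S →⋆ₐ[ℂ] F) (hφ : Function.Injective φ) {s : Set F} (hs : s ⊆ Set.range φ)
    (h : (StarAlgebra.adjoin ℂ s).topologicalClosure = ⊤) : Function.Surjective φ := by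
  have hclosed : IsClosed (φ.range : Set F) := by
    have := (NonUnitalStarAlgHom.isometry φ hφ).isClosedEmbedding.isClosed_range
    exact this
  have hle : (StarAlgebra.adjoin ℂ s).topologicalClosure ≤ φ.range :=
    StarSubalgebra.topologicalClosure_minimal
      (StarAlgebra.adjoin_le hs) hclosed
  intro x
  have : x ∈ φ.range := hle (h ▸ trivial)
  exact this

namespace IsReducedAmalgFreeProd

variable {d₀ : D →⋆ₐ[ℂ] A₀} {d₁ : D →⋆ₐ[ℂ] A₁} {d₂ : D →⋆ₐ[ℂ] A₂} {E' : F →ₗ[ℂ] D}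
  {E : G →ₗ[ℂ] D}

/-- An expectation preserving inclusion of the first algebras extends to the reduced amalgamated
free products, provided that the expectation of the target is faithful. -/
theorem exists_starAlgHom (hF : IsReducedAmalgFreeProd d₀ E₀ d₂ E₂ j₁ j₂ E')
    (hG : IsReducedAmalgFreeProd d₁ E₁ d₂ E₂ ι₁ ι₂ E) (hE₀ : IsCondExp d₀ E₀)
    (hE₁ : IsCondExp d₁ E₁) (hE₂ : IsCondExp d₂ E₂) (θ : A₀ →⋆ₐ[ℂ] A₁)
    (hd : ∀ x, θ (d₀ x) = d₁ x) (hθ : ∀ a, E₁ (θ a) = E₀ a)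
    (hE : ∀ a, E (star a * a) = 0 → a = 0) :
    ∃ κ : F →⋆ₐ[ℂ] G, (∀ a, κ (j₁ a) = ι₁ (θ a)) ∧ (∀ c, κ (j₂ c) = ι₂ c) ∧
      ∀ x, E (κ x) = E' x := by
  let k₁ : A₀ →⋆ₐ[ℂ] F × G := j₁.prod (ι₁.comp θ)
  let k₂ : A₂ →⋆ₐ[ℂ] F × G := j₂.prod ι₂
  -- `Γ` will be the graph of `κ`: it is generated by the pairs that `κ` has to match.
  let Γ : StarSubalgebra ℂ (F × G) :=
    (StarAlgebra.adjoin ℂ (Set.range k₁ ∪ Set.range k₂)).topologicalClosure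
  have : IsClosed (Γ : Set (F × G)) := StarSubalgebra.isClosed_topologicalClosure _
  have hk₁ : ∀ a, k₁ a ∈ Γ := fun a =>
    StarSubalgebra.le_topologicalClosure _ (StarAlgebra.subset_adjoin _ _ (Or.inl ⟨a, rfl⟩))
  have hk₂ : ∀ c, k₂ c ∈ Γ := fun c =>
    StarSubalgebra.le_topologicalClosure _ (StarAlgebra.subset_adjoin _ _ (Or.inr ⟨c, rfl⟩))
  have hk : ∀ x, k₁ (d₀ x) = k₂ (d₂ x) := fun x =>
    Prod.ext (hF.amalgamated x) (by
      change ι₁ (θ (d₀ x)) = ι₂ (d₂ x)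
      rw [hd, hG.amalgamated])
  have hEE : ∀ u ∈ Γ, E' u.1 = E u.2 := by
    intro u hu
    let φ : F × G →ₗ[ℂ] D := E' ∘ₗ LinearMap.fst ℂ F G - E ∘ₗ LinearMap.snd ℂ F G
    have hφ : Continuous φ := by
      have h1 := hF.condExp.continuous
      have h2 := hG.condExp.continuous
      change Continuous fun u : F × G => E' u.1 - E u.2
      fun_prop
    have hle : reducedWords k₁ E₀ k₂ E₂ ≤ LinearMap.ker φ := by
      refine sup_le ?_ fun y hy => ?_
      · rintro _ ⟨a, rfl⟩
        change E' (j₁ a) - E (ι₁ (θ a)) = 0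
        rw [hF.extends₁, hG.extends₁, hθ, sub_self]
      · have h1 := map_mul_oddWords_mul_le (ι₁ := j₁) (E₁ := E₀) (ι₂ := j₂)
          (StarAlgHom.fst ℂ F G) (StarAlgHom.id ℂ A₀) (fun _ => rfl) (fun _ => rfl)
          (fun _ => rfl) (Submodule.mem_map_of_mem hy)
        have h2 := map_mul_oddWords_mul_le (ι₁ := ι₁) (E₁ := E₁) (ι₂ := ι₂)
          (StarAlgHom.snd ℂ F G) θ hθ (fun _ => rfl) (fun _ => rfl) (Submodule.mem_map_of_mem hy)
        have h1 : E' y.1 = 0 := hF.apply_eq_zero hE₀ hE₂ h1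
        have h2 : E y.2 = 0 := hG.apply_eq_zero hE₁ hE₂ h2
        change E' y.1 - E y.2 = 0
        rw [h1, h2, sub_self]
    have := Submodule.topologicalClosure_minimal _ hle (isClosed_singleton.preimage hφ)
      (mem_topologicalClosure_reducedWords hE₀ hE₂ hk hu)
    exact sub_eq_zero.1 this
  let π : Γ →⋆ₐ[ℂ] F := (StarAlgHom.fst ℂ F G).comp Γ.subtype
  -- The two expectations agree on `Γ`, so when the first coordinate vanishes, faithfulness of `E`
  -- kills the second.
  have hinj : Function.Injective π := by
    rw [injective_iff_map_eq_zero]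
    intro u hu
    have hu1 : u.1.1 = 0 := hu
    have h := hEE (star u * u : Γ) (star u * u).2
    have h : E' (star u.1.1 * u.1.1) = E (star u.1.2 * u.1.2) := h
    rw [hu1, mul_zero, map_zero] at h
    exact Subtype.ext (Prod.ext hu1 (hE _ h.symm))
  have hsurj : Function.Surjective π := by
    refine π.surjective_of_injective_of_generates hinj ?_ hF.generates
    rintro _ (⟨a, rfl⟩ | ⟨c, rfl⟩)
    · exact ⟨⟨k₁ a, hk₁ a⟩, rfl⟩
    · exact ⟨⟨k₂ c, hk₂ c⟩, rfl⟩
  let e : Γ ≃⋆ₐ[ℂ] F := StarAlgEquiv.ofBijective π ⟨hinj, hsurj⟩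
  have he : ∀ u : Γ, e.symm u.1.1 = u := fun u => e.symm_apply_apply u
  refine ⟨((StarAlgHom.snd ℂ F G).comp Γ.subtype).comp (e.symm : F →⋆ₐ[ℂ] Γ), fun a => ?_,
    fun c => ?_, fun x => ?_⟩
  · have := he ⟨k₁ a, hk₁ a⟩
    exact congrArg (fun u : Γ => u.1.2) this
  · have := he ⟨k₂ c, hk₂ c⟩
    exact congrArg (fun u : Γ => u.1.2) this
  · obtain ⟨u, rfl⟩ := hsurj x
    change E (e.symm u.1.1).1.2 = E' u.1.1
    rw [he u, hEE u u.2]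

end IsReducedAmalgFreeProd

end Functoriality

/-! ### Conditional expectations of corners -/

/-- For `x = E a - E' a`, the element `x*x` is the difference of the two expectations of `x*a`,
which have equal trace. -/
theorem IsCondExp.ext_of_trace {D A : Type*} [CStarAlgebra D] [CStarAlgebra A]
    {d : D →⋆ₐ[ℂ] A} {E E' : A →ₗ[ℂ] D} (hE : IsCondExp d E) (hE' : IsCondExp d E')
    {φ : A →ₗ[ℂ] ℂ} (hφ : ∀ x, φ (d (star x * x)) = 0 → x = 0) (h : ∀ a, φ (d (E a)) = φ a)
    (h' : ∀ a, φ (d (E' a)) = φ a) : E = E' := by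
  ext a
  refine sub_eq_zero.1 (hφ _ ?_)
  set x := E a - E' a
  have : star x * x = E (d (star x) * a) - E' (d (star x) * a) := by
    rw [hE.map_mul_left, hE'.map_mul_left, ← mul_sub]
  rw [this, map_sub, map_sub, h, h', sub_self]

namespace Corner

variable {A : Type*} [CStarAlgebra A] {e : A} {he : IsStarProjection e}

theorem unit_mul (x : Corner he) : e * x.1 = x.1 := x.2.1

theorem mul_unit (x : Corner he) : x.1 * e = x.1 := x.2.2

theorem coe_mul (x y : Corner he) : (x * y).1 = x.1 * y.1 := rfl

theorem coe_add (x y : Corner he) : (x + y).1 = x.1 + y.1 := rfl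

theorem coe_smul (c : ℂ) (x : Corner he) : (c • x).1 = c • x.1 := rfl

theorem coe_star (x : Corner he) : (star x).1 = star x.1 := rfl

theorem isometry_coe : Isometry (fun x : Corner he => x.1) := fun _ _ => rfl

end Corner

namespace IsProjTriple

variable {A₁ : Type*} [CStarAlgebra A₁] {p r r' : A₁}

/-- `p` as an element of `ℂp ⊕ ℂr`. -/
def cornerP (h : IsProjTriple p r r') : Corner h.proj_unitPR :=
  ⟨⟨p, 1, 0, 0, by simp⟩, by
    refine ⟨Subtype.ext ?_, Subtype.ext ?_⟩
    · change (p + r) * p = p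
      rw [add_mul, h.proj_p.isIdempotentElem.eq, h.mul_rp, add_zero]
    · change p * (p + r) = p
      rw [mul_add, h.proj_p.isIdempotentElem.eq, h.mul_pr, add_zero]⟩

/-- `r` as an element of `ℂp ⊕ ℂr`. -/
def cornerR (h : IsProjTriple p r r') : Corner h.proj_unitPR :=
  ⟨⟨r, 0, 1, 0, by simp⟩, by
    refine ⟨Subtype.ext ?_, Subtype.ext ?_⟩
    · change (p + r) * r = r
      rw [add_mul, h.proj_r.isIdempotentElem.eq, h.mul_pr, zero_add]
    · change r * (p + r) = r
      rw [mul_add, h.proj_r.isIdempotentElem.eq, h.mul_rp, zero_add]⟩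

theorem exists_corner_eq (h : IsProjTriple p r r') (x : Corner h.proj_unitPR) :
    ∃ a b : ℂ, x = a • h.cornerP + b • h.cornerR := by
  obtain ⟨a, b, c, hx⟩ := x.1.2
  refine ⟨a, b, Subtype.ext (Subtype.ext ?_)⟩
  have h1 : (p + r) * x.1.1 = x.1.1 := congrArg Subtype.val x.2.1
  change x.1.1 = a • p + b • r
  rw [← h1, hx]
  simpa using h.mul_comb 1 1 0 a b c

theorem cornerP_mul_cornerP (h : IsProjTriple p r r') : h.cornerP * h.cornerP = h.cornerP :=
  Subtype.ext (Subtype.ext h.proj_p.isIdempotentElem)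

theorem cornerR_mul_cornerR (h : IsProjTriple p r r') : h.cornerR * h.cornerR = h.cornerR :=
  Subtype.ext (Subtype.ext h.proj_r.isIdempotentElem)

theorem cornerP_mul_cornerR (h : IsProjTriple p r r') : h.cornerP * h.cornerR = 0 :=
  Subtype.ext (Subtype.ext h.mul_pr)

theorem cornerR_mul_cornerP (h : IsProjTriple p r r') : h.cornerR * h.cornerP = 0 :=
  Subtype.ext (Subtype.ext h.mul_rp)

theorem star_cornerP (h : IsProjTriple p r r') : star h.cornerP = h.cornerP :=
  Subtype.ext (Subtype.ext h.proj_p.isSelfAdjoint)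

theorem star_cornerR (h : IsProjTriple p r r') : star h.cornerR = h.cornerR :=
  Subtype.ext (Subtype.ext h.proj_r.isSelfAdjoint)

theorem one_eq_cornerP_add_cornerR (h : IsProjTriple p r r') : 1 = h.cornerP + h.cornerR := rfl

variable {d₁ : ℂ × ℂ →⋆ₐ[ℂ] A₁} {E₁ : A₁ →ₗ[ℂ] ℂ × ℂ} {F : Type*} [CStarAlgebra F]
  {E : F →ₗ[ℂ] ℂ × ℂ} {e : F}

/-- The formula for the conditional expectation of a corner onto `ℂp ⊕ ℂr`; here `s` is the value
of the expectation at `r`. -/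
noncomputable def cornerExp (h : IsProjTriple p r r') (E : F →ₗ[ℂ] ℂ × ℂ)
    (he : IsStarProjection e) (s : ℂ) : Corner he →ₗ[ℂ] Corner h.proj_unitPR where
  toFun a := (E a.1).1 • h.cornerP + ((E a.1).2 / s) • h.cornerR
  map_add' a b := by
    rw [Corner.coe_add, map_add, Prod.fst_add, Prod.snd_add, add_div, add_smul, add_smul]
    abel
  map_smul' c a := by
    rw [Corner.coe_smul, map_smul, Prod.smul_fst, Prod.smul_snd, smul_eq_mul, smul_eq_mul,
      mul_div_assoc, RingHom.id_apply, smul_add, smul_smul, smul_smul]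

theorem cornerExp_apply (h : IsProjTriple p r r') (he : IsStarProjection e) (s : ℂ)
    (a : Corner he) :
    h.cornerExp E he s a = (E a.1).1 • h.cornerP + ((E a.1).2 / s) • h.cornerR := rfl

/-- As `q = 1 - p` and `e = p + r`, the projection `q` acts on the corner as `r` does. So the
bimodule property over `D` becomes one over `D'`, and only the normalisation at `r` needs
correcting. The map `θ` lets one statement serve `A₁`, `C'` and `A`. -/
theorem exists_corner_condExp (h : IsProjTriple p r r') (hp : d₁ (1, 0) = p)
    (hq : d₁ (0, 1) = r + r') (hf : ∀ a, E₁ (star a * a) = 0 → a = 0)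
    (θ : h.alg →⋆ₐ[ℂ] F) (hE : IsCondExp (θ.comp (h.inclD d₁ hp hq)) E)
    (hθ : ∀ t : h.alg, E (θ t) = E₁ t) (he : IsStarProjection e) (hθe : θ h.unitPR = e) :
    ∃ E'' : Corner he →ₗ[ℂ] Corner h.proj_unitPR,
      IsCondExp (Corner.map h.proj_unitPR he θ hθe) E'' ∧
      (∀ a, E (θ (E'' a).1) = E a.1) ∧ ∀ a : Corner he, E a.1 = 0 → E'' a = 0 := by
  set i : Corner h.proj_unitPR →⋆ₐ[ℂ] Corner he := Corner.map h.proj_unitPR he θ hθe with hi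
  set s : ℂ := (E₁ r).2
  have hdP : θ.comp (h.inclD d₁ hp hq) (1, 0) = (i h.cornerP).1 :=
    congrArg θ (Subtype.ext hp)
  have hQ1 : θ.comp (h.inclD d₁ hp hq) (0, 1) = 1 - (i h.cornerP).1 := by
    rw [← hdP, ← map_one (θ.comp (h.inclD d₁ hp hq)), ← map_sub]
    congr 1
    ext <;> simp
  have he1 : (i h.cornerP).1 + (i h.cornerR).1 = e := (map_add θ _ _).symm.trans hθe
  have hQ : ∀ a : Corner he, θ.comp (h.inclD d₁ hp hq) (0, 1) * a.1 = (i h.cornerR).1 * a.1 := by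
    intro a
    rw [hQ1, sub_mul, one_mul, sub_eq_iff_eq_add', ← add_mul, he1, a.unit_mul]
  have hQ' : ∀ a : Corner he, a.1 * θ.comp (h.inclD d₁ hp hq) (0, 1) = a.1 * (i h.cornerR).1 := by
    intro a
    rw [hQ1, mul_sub, mul_one, sub_eq_iff_eq_add', ← mul_add, he1, a.mul_unit]
  have hPl : ∀ a : Corner he, E (i h.cornerP * a).1 = (1, 0) * E a.1 := fun a => by
    rw [Corner.coe_mul, ← hdP, hE.map_mul_left]
  have hPr : ∀ a : Corner he, E (a * i h.cornerP).1 = E a.1 * (1, 0) := fun a => by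
    rw [Corner.coe_mul, ← hdP, hE.map_mul_right]
  have hRl : ∀ a : Corner he, E (i h.cornerR * a).1 = (0, 1) * E a.1 := fun a => by
    rw [Corner.coe_mul, ← hQ, hE.map_mul_left]
  have hRr : ∀ a : Corner he, E (a * i h.cornerR).1 = E a.1 * (0, 1) := fun a => by
    rw [Corner.coe_mul, ← hQ', hE.map_mul_right]
  have hl : ∀ (a b : ℂ) (x : Corner he),
      E (i (a • h.cornerP + b • h.cornerR) * x).1 = (a, b) * E x.1 := by
    intro a b x
    rw [map_add, map_smul, map_smul, add_mul, smul_mul_assoc, smul_mul_assoc, Corner.coe_add,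
      Corner.coe_smul, Corner.coe_smul, map_add, map_smul, map_smul, hPl, hRl]
    ext <;> simp
  have hr : ∀ (a b : ℂ) (x : Corner he),
      E (x * i (a • h.cornerP + b • h.cornerR)).1 = E x.1 * (a, b) := by
    intro a b x
    rw [map_add, map_smul, map_smul, mul_add, mul_smul_comm, mul_smul_comm, Corner.coe_add,
      Corner.coe_smul, Corner.coe_smul, map_add, map_smul, map_smul, hPr, hRr]
    ext <;> simp [mul_comm]
  have hEP : E (i h.cornerP).1 = (1, 0) := by
    rw [← hdP, hE.apply_inclusion]
  have hER : E (i h.cornerR).1 = (0, s) := by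
    have h1 : E (i h.cornerR).1 = E₁ r := hθ _
    have h2 := hRl (i h.cornerR)
    rw [← map_mul, h.cornerR_mul_cornerR, h1] at h2
    rw [h1]
    ext
    · rw [h2]
      simp
    · rfl
  have hE1 : E (1 : Corner he).1 = (1, s) := by
    rw [← map_one i, h.one_eq_cornerP_add_cornerR, map_add, Corner.coe_add, map_add, hEP, hER]
    simp
  -- By faithfulness `s` vanishes only in the degenerate case `r = 0`, so the convention `x / 0 = 0`
  -- does no harm.
  have hs0 : s = 0 → h.cornerR = 0 := by
    intro h0
    have h1 : E₁ r = 0 := by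
      have : E (i h.cornerR).1 = E₁ r := hθ _
      rw [← this, hER, h0]
      rfl
    refine Subtype.ext (Subtype.ext (hf r ?_))
    rw [h.proj_r.isSelfAdjoint.star_eq, h.proj_r.isIdempotentElem.eq, h1]
  have hs0' : s = 0 → ∀ a : Corner he, (E a.1).2 = 0 := by
    intro h0 a
    have := hRl a
    rw [hs0 h0, map_zero, zero_mul] at this
    have h2 : E (0 : Corner he).1 = 0 := map_zero E
    rw [h2] at this
    have := congrArg Prod.snd this
    simpa using this.symm
  have hi0 : ∀ x y : ℂ, E (i (x • h.cornerP + y • h.cornerR)).1 = (x, y * s) := by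
    intro x y
    have := hl x y 1
    rw [mul_one, hE1] at this
    simpa using this
  refine ⟨h.cornerExp E he s, ⟨?_, ?_, ?_⟩, ?_, ?_⟩
  · intro x
    obtain ⟨a, b, rfl⟩ := h.exists_corner_eq x
    rw [h.cornerExp_apply, hi0]
    by_cases h0 : s = 0
    · rw [hs0 h0]
      simp
    · rw [mul_div_cancel_right₀ _ h0]
  · intro x a y
    obtain ⟨b, c, rfl⟩ := h.exists_corner_eq x
    obtain ⟨b', c', rfl⟩ := h.exists_corner_eq y
    rw [h.cornerExp_apply, h.cornerExp_apply, hr, hl]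
    simp only [add_mul, mul_add, smul_mul_smul_comm, h.cornerP_mul_cornerP,
      h.cornerR_mul_cornerR, h.cornerP_mul_cornerR, h.cornerR_mul_cornerP, smul_zero, add_zero,
      zero_add, Prod.fst_mul, Prod.snd_mul]
    congr 2
    ring
  · intro a
    obtain ⟨b, hb⟩ := hE.positive a.1
    obtain ⟨m, hm⟩ := hE.positive (i h.cornerR).1
    have hm2 : s = star m.2 * m.2 := by
      have h1 : star (i h.cornerR).1 * (i h.cornerR).1 = (i h.cornerR).1 := by
        rw [← Corner.coe_star, ← Corner.coe_mul, ← map_star, ← map_mul, h.star_cornerR,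
          h.cornerR_mul_cornerR]
      rw [h1, hER] at hm
      exact congrArg Prod.snd hm
    -- Since `s = |m.2|²`, dividing `b.2` by `m.2` produces the factor `1 / s` in the square.
    refine ⟨b.1 • h.cornerP + (b.2 / m.2) • h.cornerR, ?_⟩
    rw [h.cornerExp_apply, Corner.coe_mul, Corner.coe_star, hb, star_add, star_smul, star_smul, h.star_cornerP, h.star_cornerR]
    simp only [add_mul, mul_add, smul_mul_smul_comm, h.cornerP_mul_cornerP,
      h.cornerR_mul_cornerR, h.cornerP_mul_cornerR, h.cornerR_mul_cornerP, smul_zero, add_zero,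
      zero_add, Prod.fst_mul, Prod.snd_mul, Prod.fst_star, Prod.snd_star]
    rw [star_div₀, div_mul_div_comm, ← hm2]
  · intro a
    rw [h.cornerExp_apply]
    refine (hi0 _ _).trans ?_
    by_cases h0 : s = 0
    · ext
      · rfl
      · simp [h0, hs0' h0 a]
    · rw [div_mul_cancel₀ _ h0]
  · intro a ha
    rw [h.cornerExp_apply, ha]
    simp

end IsProjTriple

theorem Submodule.topologicalClosure_mul_le {F : Type*} [CStarAlgebra F] (M N : Submodule ℂ F) :
    M.topologicalClosure * N.topologicalClosure ≤ (M * N).topologicalClosure := by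
  rw [Submodule.mul_le]
  intro m hm n hn
  exact map_mem_closure₂ continuous_mul hm hn fun a ha b hb => Submodule.mul_mem_mul ha hb

/-! ### Alternating products with letters in the closure of the reduced words -/

section Alternating

variable {D A₁ A₂ G X Y : Type*} [CStarAlgebra D] [CStarAlgebra A₁] [CStarAlgebra A₂]
  [CStarAlgebra G] {ι₁ : A₁ →⋆ₐ[ℂ] G} {E₁ : A₁ →ₗ[ℂ] D} {ι₂ : A₂ →⋆ₐ[ℂ] G} {E₂ : A₂ →ₗ[ℂ] D}

/-- Induction from the right. The invariant records only the first letter, since the right-hand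
factor may be any element of the first algebra; closures appear because `K` is only approximated by
words. -/
theorem alternating_prod_mem {T B K : Submodule ℂ G} (hT : T ≤ imageSubmodule ι₁)
    (hB : B ≤ centredSubmodule ι₁ E₁) (hTB : T * B ≤ B) (hBT : B * T ≤ B)
    (hK : K ≤ (T * oddWords ι₁ E₁ ι₂ E₂ * T).topologicalClosure) (f : X ⊕ Y → G)
    (w : List (X ⊕ Y)) (hw : w.IsChain (fun x y => x.isLeft ≠ y.isLeft))
    (hf : ∀ x ∈ w, f x ∈ if x.isLeft then B else K) :
    ∀ x ∈ w.head?, (w.map f).prod ∈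
      (if x.isLeft then B ⊔ B * oddWords ι₁ E₁ ι₂ E₂ * imageSubmodule ι₁
        else T * oddWords ι₁ E₁ ι₂ E₂ * imageSubmodule ι₁).topologicalClosure := by
  set W := oddWords ι₁ E₁ ι₂ E₂
  set R := imageSubmodule ι₁
  have hBR : B ≤ R := hB.trans (centredSubmodule_le_imageSubmodule _ _)
  have hWBW : W * B * W ≤ W :=
    (mul_le_mul_left (mul_le_mul_right hB _) _).trans oddWords_mul_centred_mul_oddWords_le
  induction w with
  | nil => simp
  | cons y l ih =>
    rintro x hx
    obtain rfl : y = x := by simpa using hx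
    have hy := hf y List.mem_cons_self
    have ih := ih hw.of_cons fun x hx => hf x (List.mem_cons_of_mem _ hx)
    rw [List.map_cons, List.prod_cons]
    cases l with
    | nil =>
      rw [List.map_nil, List.prod_nil, mul_one]
      rcases y with y | y
      · simp only [Sum.isLeft_inl, if_true] at hy ⊢
        exact Submodule.le_topologicalClosure _ (le_sup_left (a := B) hy)
      · simp only [Sum.isLeft_inr, Bool.false_eq_true, if_false] at hy ⊢
        exact Submodule.topologicalClosure_mono (mul_le_mul_right hT _) (hK hy)
    | cons z l =>
      have hyz : y.isLeft ≠ z.isLeft := (List.isChain_cons_cons.1 hw).1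
      have ih := ih z rfl
      rcases y with y | y <;> rcases z with z | z <;> simp at hyz
      · simp only [Sum.isLeft_inl, Sum.isLeft_inr, Bool.false_eq_true, if_true, if_false]
          at hy ih ⊢
        have h1 := Submodule.topologicalClosure_mul_le _ _
          (Submodule.mul_mem_mul (Submodule.le_topologicalClosure _ hy) ih)
        refine Submodule.topologicalClosure_mono (le_sup_of_le_right ?_) h1
        rw [← mul_assoc, ← mul_assoc]
        gcongr
      · simp only [Sum.isLeft_inl, Sum.isLeft_inr, Bool.false_eq_true, if_true, if_false]
          at hy ih ⊢
        -- Here `TWT` meets `B + BWR`: `TB ≤ B` removes the inner `T`, then `B ≤ R` settles the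
        -- first summand and `WBW ≤ W` the second.
        have h1 := Submodule.topologicalClosure_mul_le _ _ (Submodule.mul_mem_mul (hK hy) ih)
        refine Submodule.topologicalClosure_mono ?_ h1
        rw [Submodule.mul_sup, ← mul_assoc, ← mul_assoc, mul_assoc _ T B]
        refine sup_le ?_ ?_
        · gcongr
          exact hTB.trans hBR
        · refine (mul_le_mul_left (mul_le_mul_left (mul_le_mul_right hTB _) _) _).trans ?_
          rw [mul_assoc T W B, mul_assoc T _ W]
          gcongr

theorem IsReducedAmalgFreeProd.apply_alternating_prod {d₁ : D →⋆ₐ[ℂ] A₁} {d₂ : D →⋆ₐ[ℂ] A₂}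
    {E : G →ₗ[ℂ] D} (hG : IsReducedAmalgFreeProd d₁ E₁ d₂ E₂ ι₁ ι₂ E) (hE₁ : IsCondExp d₁ E₁)
    (hE₂ : IsCondExp d₂ E₂) {T B K : Submodule ℂ G} (hT : T ≤ imageSubmodule ι₁)
    (hB : B ≤ centredSubmodule ι₁ E₁) (hTB : T * B ≤ B) (hBT : B * T ≤ B)
    (hK : K ≤ (T * oddWords ι₁ E₁ ι₂ E₂ * T).topologicalClosure) (f : X ⊕ Y → G)
    {w : List (X ⊕ Y)} (hw0 : w ≠ []) (hw : w.IsChain (fun x y => x.isLeft ≠ y.isLeft))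
    (hf : ∀ x ∈ w, f x ∈ if x.isLeft then B else K) : E (w.map f).prod = 0 := by
  have hmem := alternating_prod_mem hT hB hTB hBT hK f w hw hf (w.head hw0)
    (List.head?_eq_some_head hw0)
  refine Submodule.topologicalClosure_minimal (t := LinearMap.ker E) _ ?_
    (isClosed_singleton.preimage hG.condExp.continuous) hmem
  have hRWR : imageSubmodule ι₁ * oddWords ι₁ E₁ ι₂ E₂ * imageSubmodule ι₁ ≤ LinearMap.ker E :=
    fun x hx => hG.apply_eq_zero hE₁ hE₂ hx
  have hBR : B ≤ imageSubmodule ι₁ := hB.trans (centredSubmodule_le_imageSubmodule _ _)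
  split_ifs
  · refine sup_le ?_ (le_trans (by gcongr) hRWR)
    intro x hx
    obtain ⟨a, ha, rfl⟩ := hB hx
    exact (hG.extends₁ a).trans ha
  · exact le_trans (by gcongr) hRWR

end Alternating

/-! ### Compressions to corners -/

namespace Corner

/-- The compression `a ↦ e a e`. -/
noncomputable def compress {A : Type*} [CStarAlgebra A] {e : A} (he : IsStarProjection e) :
    A →ₗ[ℂ] Corner he where
  toFun a := ⟨e * a * e, by
    refine ⟨?_, ?_⟩
    · rw [← mul_assoc, ← mul_assoc, he.isIdempotentElem.eq]
    · rw [mul_assoc, he.isIdempotentElem.eq]⟩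
  map_add' a b := Subtype.ext (by
    change e * (a + b) * e = e * a * e + e * b * e
    rw [mul_add, add_mul])
  map_smul' c a := Subtype.ext (by
    change e * (c • a) * e = c • (e * a * e)
    rw [mul_smul_comm, smul_mul_assoc])

variable {A B : Type*} [CStarAlgebra A] [CStarAlgebra B] {e : A} {he : IsStarProjection e}

theorem coe_compress (a : A) : (compress he a).1 = e * a * e := rfl

theorem compress_coe (x : Corner he) : compress he x.1 = x :=
  Subtype.ext (by rw [coe_compress, x.unit_mul, x.mul_unit])

theorem continuous_compress : Continuous (compress he) := by
  have h : Continuous fun a : A => e * a * e := by fun_prop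
  exact isometry_coe.isEmbedding.continuous_iff.2 h

theorem compress_map {f : B} {hf : IsStarProjection f} (φ : A →⋆ₐ[ℂ] B) (h : φ e = f) (a : A) :
    compress hf (φ a) = map he hf φ h (compress he a) :=
  Subtype.ext (by
    change f * φ a * f = φ (e * a * e)
    rw [map_mul, map_mul, h])

theorem mul_coe_mul (x y : Corner he) (a : A) : x.1 * a * y.1 = (x * compress he a * y).1 := by
  rw [coe_mul, coe_mul, coe_compress, ← mul_assoc, ← mul_assoc, x.mul_unit, mul_assoc, mul_assoc,
    y.unit_mul, ← mul_assoc]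

theorem compress_mul_coe_mul (x : Corner he) (a b : A) :
    compress he (a * x.1 * b) = compress he a * x * compress he b := by
  refine Subtype.ext ?_
  have h : e * (a * (e * x.1 * e) * b) * e = e * a * e * x.1 * (e * b * e) := by
    simp only [mul_assoc]
  rw [x.unit_mul, x.mul_unit] at h
  exact h

/-- Generators of a corner: if `A` is generated by the images of `A₁` and `A₂`, then the corner of
`A` is generated by the corners of the images of `A₁` and `C`, where `C` contains `A₂` and `A₁` is
contained in the sum of its corner and of `C`. -/
theorem generates {A₁ A₂ C : Type*} [CStarAlgebra A₁] [CStarAlgebra A₂] [CStarAlgebra C]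
    {ι₁ : A₁ →⋆ₐ[ℂ] A} {ι₂ : A₂ →⋆ₐ[ℂ] A} {κ : C →⋆ₐ[ℂ] A}
    (hgen : (StarAlgebra.adjoin ℂ (Set.range ι₁ ∪ Set.range ι₂)).topologicalClosure = ⊤)
    {e₁ : A₁} (he₁ : IsStarProjection e₁) {c : C} (hc : IsStarProjection c) (h₁ : ι₁ e₁ = e)
    (hκ : κ c = e) (hι₁ : ∀ a, ∃ x, ι₁ a = ι₁ (e₁ * a * e₁) + κ x) (hι₂ : ∀ a, ∃ x, ι₂ a = κ x) :
    (StarAlgebra.adjoin ℂ (Set.range (map he₁ he ι₁ h₁) ∪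
      Set.range (map hc he κ hκ))).topologicalClosure = ⊤ := by
  set S := StarAlgebra.adjoin ℂ (Set.range (map he₁ he ι₁ h₁) ∪ Set.range (map hc he κ hκ))
  have hS₁ : ∀ x, map he₁ he ι₁ h₁ x ∈ S := fun x =>
    StarAlgebra.subset_adjoin _ _ (Or.inl ⟨x, rfl⟩)
  have hS₂ : ∀ x, compress he (κ x) ∈ S := fun x =>
    StarAlgebra.subset_adjoin _ _ (Or.inr ⟨compress hc x, (compress_map κ hκ x).symm⟩)
  let g : Submodule ℂ A := S.toSubalgebra.toSubmodule.map (incl he)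
  let k : Submodule ℂ A := imageSubmodule κ
  -- `M` is stable under both algebras because `g * k * g ≤ g`: a factor from `k` between two corner
  -- elements may be replaced by its compression, which lies in `S`. Compressing the dense subspace
  -- `M` then lands in `S`.
  let M : Submodule ℂ A := k ⊔ k * g * k
  have hk : k * k ≤ k := imageSubmodule_mul_self_le κ
  have h1k : 1 ≤ k := one_le_imageSubmodule κ
  have hkM : k * M ≤ M := by
    rw [Submodule.mul_sup, ← mul_assoc, ← mul_assoc]
    change _ ≤ k ⊔ k * g * k
    gcongr
  have hgkg : g * k * g ≤ g := by
    rw [mul_assoc, Submodule.mul_le]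
    rintro _ ⟨x, hx, rfl⟩ z hz
    induction hz using Submodule.mul_induction_on' with
    | mem_mul_mem a ha b hb =>
      obtain ⟨a, rfl⟩ := ha
      obtain ⟨b, hb, rfl⟩ := hb
      refine ⟨x * compress he (κ a) * b, S.mul_mem (S.mul_mem hx (hS₂ a)) hb, ?_⟩
      refine (mul_coe_mul x b (κ a)).symm.trans ?_
      rw [mul_assoc]
      rfl
    | add a _ b _ ha hb =>
      rw [mul_add]
      exact g.add_mem ha hb
  have hgM : g * M ≤ M := by
    rw [Submodule.mul_sup]
    refine sup_le (le_sup_of_le_right ?_) (le_sup_of_le_right ?_)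
    · rw [mul_assoc]
      exact le_mul_of_one_le_left' h1k
    · rw [← mul_assoc, ← mul_assoc]
      refine mul_le_mul_left (hgkg.trans (le_mul_of_one_le_left' h1k)) _
  have hM₁ : imageSubmodule ι₁ * M ≤ M := by
    have : imageSubmodule ι₁ ≤ g ⊔ k := by
      rintro _ ⟨a, rfl⟩
      obtain ⟨x, hx⟩ := hι₁ a
      refine Submodule.mem_sup.2 ⟨_, ⟨map he₁ he ι₁ h₁ (compress he₁ a), hS₁ _, rfl⟩, κ x,
        ⟨x, rfl⟩, hx.symm⟩
    refine (mul_le_mul_left this _).trans ?_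
    rw [Submodule.sup_mul]
    exact sup_le hgM hkM
  have hM₂ : imageSubmodule ι₂ * M ≤ M := by
    refine (mul_le_mul_left ?_ _).trans hkM
    rintro _ ⟨a, rfl⟩
    obtain ⟨x, hx⟩ := hι₂ a
    exact ⟨x, hx.symm⟩
  have hcomp : ∀ m ∈ M, compress he m ∈ S := by
    have : M ≤ S.toSubalgebra.toSubmodule.comap (compress he) := by
      refine sup_le ?_ ?_
      · rintro _ ⟨x, rfl⟩
        exact hS₂ x
      · rw [Submodule.mul_le]
        intro y hy z hz
        obtain ⟨z, rfl⟩ := hz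
        change compress he (y * κ z) ∈ S
        induction hy using Submodule.mul_induction_on' with
        | mem_mul_mem a ha b hb =>
          obtain ⟨a, rfl⟩ := ha
          obtain ⟨b, hb, rfl⟩ := hb
          have := S.mul_mem (S.mul_mem (hS₂ a) hb) (hS₂ z)
          rw [← compress_mul_coe_mul] at this
          exact this
        | add a _ b _ ha hb =>
          rw [add_mul, map_add]
          exact S.add_mem ha hb
    exact this
  refine eq_top_iff.2 fun x _ => ?_
  have hx := mem_topologicalClosure_of_mul_le M (le_sup_of_le_left h1k) hM₁ hM₂ (x := x.1)
    (hgen ▸ trivial)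
  have := map_mem_closure continuous_compress hx hcomp
  rwa [compress_coe] at this

end Corner

/-! ### Pulling back traces and expectations -/

theorem IsFaithfulTrace.comp_injective {A B : Type*} [CStarAlgebra A] [CStarAlgebra B]
    {τ : B →ₗ[ℂ] ℂ} (hτ : IsFaithfulTrace τ) {φ : A →⋆ₐ[ℂ] B} (hφ : Function.Injective φ) :
    IsFaithfulTrace (τ ∘ₗ φ.toAlgHom.toLinearMap) where
  nonneg a := by
    change 0 ≤ τ (φ (star a * a))
    rw [map_mul, map_star]
    exact hτ.nonneg _
  mul_comm a b := by
    change τ (φ (a * b)) = τ (φ (b * a))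
    rw [map_mul φ, hτ.mul_comm, map_mul φ]
  faithful a ha := by
    change τ (φ (star a * a)) = 0 at ha
    rw [map_mul, map_star] at ha
    exact (map_eq_zero_iff φ hφ).1 (hτ.faithful _ ha)

theorem IsCondExp.comp {D A₀ A : Type*} [CStarAlgebra D] [CStarAlgebra A₀] [CStarAlgebra A]
    {d : D →⋆ₐ[ℂ] A} {E : A →ₗ[ℂ] D} (hE : IsCondExp d E) {d₀ : D →⋆ₐ[ℂ] A₀} (θ : A₀ →⋆ₐ[ℂ] A)
    (hθ : ∀ x, θ (d₀ x) = d x) : IsCondExp d₀ (E ∘ₗ θ.toAlgHom.toLinearMap) where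
  apply_inclusion x := by
    change E (θ (d₀ x)) = x
    rw [hθ, hE.apply_inclusion]
  bimodule x a y := by
    change E (θ (d₀ x * a * d₀ y)) = x * E (θ a) * y
    rw [map_mul θ, map_mul θ, hθ, hθ, hE.bimodule]
  positive a := by
    obtain ⟨b, hb⟩ := hE.positive (θ a)
    refine ⟨b, ?_⟩
    change E (θ (star a * a)) = _
    rw [map_mul, map_star, hb]

theorem IsReducedAmalgFreeProd.injective_of_apply_eq {D A₁ A₂ F G : Type*} [CStarAlgebra D]
    [CStarAlgebra A₁] [CStarAlgebra A₂] [CStarAlgebra F] [CStarAlgebra G] {d₁ : D →⋆ₐ[ℂ] A₁}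
    {E₁ : A₁ →ₗ[ℂ] D} {d₂ : D →⋆ₐ[ℂ] A₂} {E₂ : A₂ →ₗ[ℂ] D} {ι₁ : A₁ →⋆ₐ[ℂ] F}
    {ι₂ : A₂ →⋆ₐ[ℂ] F} {E : F →ₗ[ℂ] D} (hF : IsReducedAmalgFreeProd d₁ E₁ d₂ E₂ ι₁ ι₂ E)
    (κ : F →⋆ₐ[ℂ] G) {E' : G →ₗ[ℂ] D} (hκ : ∀ x, E' (κ x) = E x) : Function.Injective κ := by
  rw [injective_iff_map_eq_zero]
  intro x hx
  refine hF.gns_faithful x fun y => ?_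
  rw [← hκ, map_mul κ, map_mul κ, hx, zero_mul, mul_zero, map_zero]

/-! ### Centred elements of a corner -/

namespace IsProjTriple

variable {A₁ : Type*} [CStarAlgebra A₁] {p r r' : A₁}

theorem mul_unitPR (h : IsProjTriple p r r') (t : h.alg) : t * h.unitPR = h.unitPR * t := by
  obtain ⟨a, b, c, ht⟩ := t.2
  refine Subtype.ext ?_
  change t.1 * (p + r) = (p + r) * t.1
  have h1 := h.mul_comb a b c 1 1 0
  have h2 := h.mul_comb 1 1 0 a b c
  rw [ht]
  simp only [one_smul, zero_smul, add_zero, mul_one, one_mul, mul_zero, zero_mul] at h1 h2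
  rw [h1, h2]

theorem coe_compress_unitPR (h : IsProjTriple p r r') (t : h.alg) :
    (Corner.compress h.proj_unitPR t).1 = t * h.unitPR := by
  rw [Corner.coe_compress, ← h.mul_unitPR, mul_assoc, h.proj_unitPR.isIdempotentElem.eq]

section

variable {F : Type*} [CStarAlgebra F] {e : F} {he : IsStarProjection e}

/-- The projection `r'` annihilates the corner, so the triple algebra acts on it through `D'`. -/
theorem mul_corner_eq (h : IsProjTriple p r r') (θ : h.alg →⋆ₐ[ℂ] F) (hθ : θ h.unitPR = e)
    (t : h.alg) (x : Corner he) :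
    θ t * x.1 = (Corner.map h.proj_unitPR he θ hθ (Corner.compress h.proj_unitPR t) * x).1 := by
  rw [Corner.coe_mul]
  change _ = θ (Corner.compress h.proj_unitPR t).1 * x.1
  rw [h.coe_compress_unitPR, map_mul, hθ, mul_assoc, x.unit_mul]

theorem corner_mul_eq (h : IsProjTriple p r r') (θ : h.alg →⋆ₐ[ℂ] F) (hθ : θ h.unitPR = e)
    (t : h.alg) (x : Corner he) :
    x.1 * θ t = (x * Corner.map h.proj_unitPR he θ hθ (Corner.compress h.proj_unitPR t)).1 := by
  rw [Corner.coe_mul]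
  change _ = x.1 * θ (Corner.compress h.proj_unitPR t).1
  rw [h.coe_compress_unitPR, h.mul_unitPR, map_mul, hθ, ← mul_assoc, x.mul_unit]

/-- An element of the corner with expectation zero is a limit of words that contain an element of
the second algebra. -/
theorem mem_closure_words (h : IsProjTriple p r r') {D A₂ : Type*} [CStarAlgebra D]
    [CStarAlgebra A₂] {d₀ : D →⋆ₐ[ℂ] h.alg} {E₀ : h.alg →ₗ[ℂ] D} {d₂ : D →⋆ₐ[ℂ] A₂}
    {E₂ : A₂ →ₗ[ℂ] D} {j₁ : h.alg →⋆ₐ[ℂ] F} {j₂ : A₂ →⋆ₐ[ℂ] F} {E : F →ₗ[ℂ] D}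
    (hF : IsReducedAmalgFreeProd d₀ E₀ d₂ E₂ j₁ j₂ E) (hE₀ : IsCondExp d₀ E₀)
    (hE₂ : IsCondExp d₂ E₂) (hj : j₁ h.unitPR = e) {E' : Corner he →ₗ[ℂ] Corner h.proj_unitPR}
    (hE' : IsCondExp (Corner.map h.proj_unitPR he j₁ hj) E')
    (hE'0 : ∀ a : Corner he, E a.1 = 0 → E' a = 0) {x : Corner he} (hx : E' x = 0) :
    x.1 ∈ (imageSubmodule j₁ * oddWords j₁ E₀ j₂ E₂ * imageSubmodule j₁).topologicalClosure := by
  set M := imageSubmodule j₁ * oddWords j₁ E₀ j₂ E₂ * imageSubmodule j₁ with hM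
  set i := Corner.map h.proj_unitPR he j₁ hj
  have hR := imageSubmodule_mul_self_le j₁
  have heM : ∀ y ∈ M, (Corner.compress he y).1 ∈ M := by
    intro y hy
    have he₁ : e ∈ imageSubmodule j₁ := ⟨_, hj⟩
    have h1 := Submodule.mul_mem_mul (Submodule.mul_mem_mul he₁ hy) he₁
    refine (?_ : imageSubmodule j₁ * M * imageSubmodule j₁ ≤ M) h1
    rw [hM, ← mul_assoc, ← mul_assoc, mul_assoc _ (imageSubmodule j₁) (imageSubmodule j₁)]
    gcongr
  -- `Φ` fixes `x`. It sends reduced words into `M`: elements of the triple algebra compress into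
  -- `D'` and cancel, while `E'` vanishes on compressed elements of `M`.
  let Φ : F → F := fun y => (Corner.compress he y - i (E' (Corner.compress he y))).1
  have hΦ : Continuous Φ := by
    have h1 := hE'.continuous
    have h2 : Continuous i := (i.toAlgHom.toLinearMap.mkContinuous 1
      (by simpa using NonUnitalStarAlgHom.norm_apply_le i)).continuous
    have h3 := Corner.continuous_compress (he := he)
    exact Corner.isometry_coe.continuous.comp (h3.sub (h2.comp (h1.comp h3)))
  have hΦM : ∀ y ∈ reducedWords j₁ E₀ j₂ E₂, Φ y ∈ M := by
    intro y hy
    obtain ⟨_, ⟨t, rfl⟩, z, hz, rfl⟩ := Submodule.mem_sup.1 hy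
    have h1 : Corner.compress he (j₁ t) = i (Corner.compress h.proj_unitPR t) :=
      Corner.compress_map j₁ hj t
    have h2 : E' (Corner.compress he z) = 0 :=
      hE'0 _ (hF.apply_eq_zero hE₀ hE₂ (heM z hz))
    change (Corner.compress he (j₁ t + z) - i (E' (Corner.compress he (j₁ t + z)))).1 ∈ M
    rw [map_add, map_add, h2, h1, hE'.apply_inclusion, add_zero, add_sub_cancel_left]
    exact heM z hz
  have := map_mem_closure hΦ (hF.mem_closure_reducedWords hE₀ hE₂ x.1) hΦM
  have hx1 : Φ x.1 = x.1 := by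
    change (Corner.compress he x.1 - i (E' (Corner.compress he x.1))).1 = x.1
    rw [Corner.compress_coe, hx, map_zero, sub_zero]
  rwa [hx1] at this

end

end IsProjTriple

/-! ### The corner of the free product -/

theorem mainTheorem12
    {A₁ C A C' : Type*} [CStarAlgebra A₁] [CStarAlgebra C] [CStarAlgebra A] [CStarAlgebra C']
    -- `A₁` and `C` contain `D = ℂp ⊕ ℂq`, with `D`-valued conditional expectations and traces
    (d₁ : ℂ × ℂ →⋆ₐ[ℂ] A₁) (E₁ : A₁ →ₗ[ℂ] ℂ × ℂ) (hE₁ : IsCondExp d₁ E₁)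
    (d₂ : ℂ × ℂ →⋆ₐ[ℂ] C) (E₂ : C →ₗ[ℂ] ℂ × ℂ) (hE₂ : IsCondExp d₂ E₂)
    (tr₁ : A₁ →ₗ[ℂ] ℂ) (htr₁ : IsFaithfulTrace tr₁) (htrE₁ : ∀ a, tr₁ (d₁ (E₁ a)) = tr₁ a)
    (tr₂ : C →ₗ[ℂ] ℂ) (htr₂ : IsFaithfulTrace tr₂) (htrE₂ : ∀ c, tr₂ (d₂ (E₂ c)) = tr₂ c)
    (htrD : ∀ x, tr₁ (d₁ x) = tr₂ (d₂ x))
    -- `q = r + r'`, and `A₁ = B ⊕ ℂr'`, where `B = (p + r) A₁ (p + r)`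
    (p r r' : A₁) (h : IsProjTriple p r r') (hp : d₁ (1, 0) = p) (hq : d₁ (0, 1) = r + r')
    (hr'_central : ∀ a, a * r' = r' * a) (hr'_scalar : ∀ a, ∃ c : ℂ, a * r' = c • r')
    -- `A = (B ⊕ ℂr') *_D C`
    (ι₁ : A₁ →⋆ₐ[ℂ] A) (ι₂ : C →⋆ₐ[ℂ] A) (E : A →ₗ[ℂ] ℂ × ℂ)
    (hA : IsReducedAmalgFreeProd d₁ E₁ d₂ E₂ ι₁ ι₂ E)
    -- `C' = (ℂp ⊕ ℂr ⊕ ℂr') *_D C`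
    (j₁ : h.alg →⋆ₐ[ℂ] C') (j₂ : C →⋆ₐ[ℂ] C') (E' : C' →ₗ[ℂ] ℂ × ℂ)
    (hC' : IsReducedAmalgFreeProd (h.inclD d₁ hp hq) (E₁ ∘ₗ h.alg.subtype.toAlgHom.toLinearMap)
      d₂ E₂ j₁ j₂ E') :
    -- the projection `p + r` in `C'` and in `A`
    let eC' : IsStarProjection (j₁ h.unitPR) := h.proj_unitPR.map j₁
    let eA : IsStarProjection (ι₁ (p + r)) := h.proj_add.map ι₁
    -- `D' = ℂp ⊕ ℂr` is the corner of `ℂp ⊕ ℂr ⊕ ℂr'` at `p + r`, and it is contained in `B`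
    -- and in `(p + r) C' (p + r)`
    let d₁' : Corner h.proj_unitPR →⋆ₐ[ℂ] Corner h.proj_add :=
      Corner.map h.proj_unitPR h.proj_add h.alg.subtype rfl
    let d₂' : Corner h.proj_unitPR →⋆ₐ[ℂ] Corner eC' :=
      Corner.map h.proj_unitPR eC' j₁ rfl
    -- the traces on `B`, on `(p + r) C' (p + r)` and on `(p + r) A (p + r)`
    let trB : Corner h.proj_add →ₗ[ℂ] ℂ := tr₁ ∘ₗ Corner.incl h.proj_add
    let trC' : Corner eC' →ₗ[ℂ] ℂ :=
      tr₁ ∘ₗ d₁.toAlgHom.toLinearMap ∘ₗ E' ∘ₗ Corner.incl eC'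
    let trA : Corner eA →ₗ[ℂ] ℂ :=
      tr₁ ∘ₗ d₁.toAlgHom.toLinearMap ∘ₗ E ∘ₗ Corner.incl eA
    -- there are unique trace preserving conditional expectations onto `D'`
    (∃! E₁' : Corner h.proj_add →ₗ[ℂ] Corner h.proj_unitPR,
      IsCondExp d₁' E₁' ∧ ∀ b, trB (d₁' (E₁' b)) = trB b) ∧
    (∃! E₂' : Corner eC' →ₗ[ℂ] Corner h.proj_unitPR,
      IsCondExp d₂' E₂' ∧ ∀ c, trC' (d₂' (E₂' c)) = trC' c) ∧
    -- `C'` is canonically contained in `A`, and for these conditional expectations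
    -- `(p + r) A (p + r) = (B, E₁') *_{D'} ((p + r) C' (p + r), E₂')`
    ∃ (κ : C' →⋆ₐ[ℂ] A) (hκ₁ : ∀ t : h.alg, κ (j₁ t) = ι₁ t), (∀ c, κ (j₂ c) = ι₂ c) ∧
      (∀ x, E (κ x) = E' x) ∧
      ∀ (E₁' : Corner h.proj_add →ₗ[ℂ] Corner h.proj_unitPR)
        (E₂' : Corner eC' →ₗ[ℂ] Corner h.proj_unitPR),
        IsCondExp d₁' E₁' → (∀ b, trB (d₁' (E₁' b)) = trB b) →
        IsCondExp d₂' E₂' → (∀ c, trC' (d₂' (E₂' c)) = trC' c) →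
        ∃ E'' : Corner eA →ₗ[ℂ] Corner h.proj_unitPR,
          IsReducedAmalgFreeProd d₁' E₁' d₂' E₂'
            (Corner.map h.proj_add eA ι₁ rfl) (Corner.map eC' eA κ (hκ₁ h.unitPR)) E'' ∧
          ∀ a, trA (Corner.map h.proj_add eA ι₁ rfl (d₁' (E'' a))) = trA a := by
  intro eC' eA d₁' d₂' trB trC' trA
  -- the trace on `D` and faithfulness of the expectations
  have hd₁ : Function.Injective d₁ := fun x y hxy => by
    rw [← hE₁.apply_inclusion x, hxy, hE₁.apply_inclusion]
  have ht : IsFaithfulTrace (tr₁ ∘ₗ d₁.toAlgHom.toLinearMap) := htr₁.comp_injective hd₁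
  have htc : Continuous (tr₁ ∘ₗ d₁.toAlgHom.toLinearMap) :=
    LinearMap.continuous_of_finiteDimensional _
  have htrA := hA.isFaithfulTrace hE₁ hE₂ htc ht
    (fun a b => by
      change tr₁ (d₁ (E₁ (a * b))) = tr₁ (d₁ (E₁ (b * a)))
      rw [htrE₁, htrE₁, htr₁.mul_comm])
    (fun a b => by
      change tr₁ (d₁ (E₂ (a * b))) = tr₁ (d₁ (E₂ (b * a)))
      rw [htrD, htrD, htrE₂, htrE₂, htr₂.mul_comm])
  have hf₁ : ∀ a, E₁ (star a * a) = 0 → a = 0 := fun a ha => by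
    refine htr₁.faithful a ?_
    rw [← htrE₁, ha, map_zero, map_zero]
  have hfA : ∀ a, E (star a * a) = 0 → a = 0 := fun a ha => by
    refine htrA.faithful a ?_
    change tr₁ (d₁ (E (star a * a))) = 0
    rw [ha, map_zero, map_zero]
  -- the canonical map from `C'` to `A`
  have hE₀ : IsCondExp (h.inclD d₁ hp hq) (E₁ ∘ₗ h.alg.subtype.toAlgHom.toLinearMap) :=
    hE₁.comp h.alg.subtype fun _ => rfl
  obtain ⟨κ, hκ₁, hκ₂, hκE⟩ := hC'.exists_starAlgHom hA hE₀ hE₁ hE₂ h.alg.subtype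
    (fun _ => rfl) (fun _ => rfl) hfA
  have hκ₁ : ∀ t : h.alg, κ (j₁ t) = ι₁ t := hκ₁
  -- the conditional expectations of the three corners
  have hdB : h.alg.subtype.comp (h.inclD d₁ hp hq) = d₁ := StarAlgHom.ext fun _ => rfl
  obtain ⟨F₁, hF₁, hF₁E, hF₁0⟩ := h.exists_corner_condExp (E := E₁) hp hq hf₁ h.alg.subtype
    (hdB.symm ▸ hE₁) (fun _ => rfl) h.proj_add rfl
  obtain ⟨F₂, hF₂, hF₂E, hF₂0⟩ := h.exists_corner_condExp hp hq hf₁ j₁ hC'.condExp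
    hC'.extends₁ eC' rfl
  obtain ⟨F, hF, hFE, hF0⟩ := h.exists_corner_condExp hp hq hf₁ (ι₁.comp h.alg.subtype)
    hA.condExp (fun t => hA.extends₁ t) eA rfl
  have hF₁t : ∀ b, trB (d₁' (F₁ b)) = trB b := fun b => by
    change tr₁ (F₁ b).1.1 = tr₁ b.1
    rw [← htrE₁, ← htrE₁ b.1, ← hF₁E]
    rfl
  have hF₂t : ∀ c, trC' (d₂' (F₂ c)) = trC' c := fun c =>
    congrArg (fun x => tr₁ (d₁ x)) (hF₂E c)
  have hfB : ∀ x, trB (d₁' (star x * x)) = 0 → x = 0 := fun x hx =>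
    Subtype.ext (Subtype.ext (htr₁.faithful x.1.1 hx))
  have hfC : ∀ x, trC' (d₂' (star x * x)) = 0 → x = 0 := fun x hx => by
    refine hfB x ?_
    have h1 : tr₁ (d₁ (E' (j₁ (star x * x).1))) = 0 := hx
    rw [hC'.extends₁] at h1
    exact (htrE₁ _).symm.trans h1
  refine ⟨⟨F₁, ⟨hF₁, hF₁t⟩, fun G hG => hG.1.ext_of_trace hF₁ hfB hG.2 hF₁t⟩,
    ⟨F₂, ⟨hF₂, hF₂t⟩, fun G hG => hG.1.ext_of_trace hF₂ hfC hG.2 hF₂t⟩,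
    κ, hκ₁, hκ₂, hκE, fun E₁' E₂' hE₁' hE₁'t hE₂' hE₂'t => ?_⟩
  obtain rfl : E₁' = F₁ := hE₁'.ext_of_trace hF₁ hfB hE₁'t hF₁t
  obtain rfl : E₂' = F₂ := hE₂'.ext_of_trace hF₂ hfC hE₂'t hF₂t
  -- `E₁` is injective on `D'`, so identities in `D'` can be tested after applying it.
  have hinj : ∀ x y : Corner h.proj_unitPR, E₁ x.1.1 = E₁ y.1.1 → x = y := fun x y hxy => by
    have h1 : E₁' (d₁' (x - y)) = 0 := hF₁0 _ (by
      change E₁ (x.1.1 - y.1.1) = 0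
      rw [map_sub, hxy, sub_self])
    rwa [hE₁'.apply_inclusion, sub_eq_zero] at h1
  have hFE : ∀ a, E₁ (F a).1.1 = E a.1 := fun a => (hA.extends₁ _).symm.trans (hFE a)
  have hFt : ∀ a, trA (Corner.map h.proj_add eA ι₁ rfl (d₁' (F a))) = trA a := fun a => by
    change tr₁ (d₁ (E (ι₁ (F a).1.1))) = tr₁ (d₁ (E a.1))
    rw [hA.extends₁, hFE]
  refine ⟨F, ⟨?_, ?_, ?_, hF, ?_, ?_, ?_, ?_, ?_⟩, hFt⟩
  · exact fun x y hxy => Subtype.ext (hA.injective₁ (congrArg Subtype.val hxy))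
  · exact fun x y hxy =>
      Subtype.ext (hC'.injective_of_apply_eq κ hκE (congrArg Subtype.val hxy))
  · exact fun x => Subtype.ext (hκ₁ x.1).symm
  · intro b
    refine hinj _ _ ?_
    rw [hFE]
    exact (hA.extends₁ b.1).trans (hF₁E b).symm
  · intro c
    refine hinj _ _ ?_
    rw [hFE]
    exact (hκE c.1).trans ((hF₂E c).symm.trans (hC'.extends₁ _))
  · refine Corner.generates hA.generates h.proj_add eC' rfl (hκ₁ h.unitPR) (fun a => ?_)
      fun c => ⟨j₂ c, (hκ₂ c).symm⟩
    obtain ⟨c, hc⟩ := hr'_scalar a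
    -- Centrality of `r'` gives `a = (p + r)a(p + r) + ar'`, and `ar' = c • r'` comes from `C'`.
    let s : h.alg := ⟨r', 0, 0, 1, by simp⟩
    refine ⟨c • j₁ s, ?_⟩
    rw [map_smul, hκ₁, ← map_smul, ← map_add]
    congr 1
    change a = (p + r) * a * (p + r) + c • r'
    have h1 : p + r = 1 - r' := eq_sub_of_add_eq h.sum_eq_one
    have h2 : r' * r' = r' := h.proj_s.isIdempotentElem
    rw [h1, ← hc, sub_mul, sub_mul, mul_sub, one_mul, mul_one, ← hr'_central a, mul_sub, mul_one,
      mul_assoc a r' r', h2]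
    abel
  · intro w hw0 hw hwc
    refine hF0 _ ?_
    let f : Corner h.proj_add ⊕ Corner eC' → A := Sum.elim (fun b => ι₁ b.1) fun c => κ c.1
    have hprod : ((w.map (Sum.elim (Corner.map h.proj_add eA ι₁ rfl)
        (Corner.map eC' eA κ (hκ₁ h.unitPR)))).prod).1 = (w.map f).prod := by
      clear hw hwc
      induction w with
      | nil => exact absurd rfl hw0
      | cons y l ih =>
        have hy : (Sum.elim (Corner.map h.proj_add eA ι₁ rfl)
          (Corner.map eC' eA κ (hκ₁ h.unitPR)) y).1 = f y := by rcases y with y | y <;> rfl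
        rw [List.map_cons, List.prod_cons, List.map_cons, List.prod_cons]
        -- The empty product is `p + r` in the corner but `1` in `A`, so the last letter is treated
        -- separately.
        by_cases hl : l = []
        · rw [hl, List.map_nil, List.prod_nil, mul_one, List.map_nil, List.prod_nil, mul_one, hy]
        · rw [Corner.coe_mul, ih hl, hy]
    rw [hprod]
    let T : Submodule ℂ A := imageSubmodule (ι₁.comp h.alg.subtype)
    let B : Submodule ℂ A :=
      (LinearMap.ker E₁').map (ι₁.toAlgHom.toLinearMap ∘ₗ Corner.incl h.proj_add)
    let K : Submodule ℂ A :=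
      (LinearMap.ker E₂').map (κ.toAlgHom.toLinearMap ∘ₗ Corner.incl eC')
    have hB : B ≤ centredSubmodule ι₁ E₁ := by
      rintro _ ⟨b, hb, rfl⟩
      refine ⟨b.1, ?_, rfl⟩
      have hb : E₁' b = 0 := hb
      have h1 : E₁ (E₁' b).1.1 = E₁ b.1 := hF₁E b
      rw [hb] at h1
      exact h1.symm.trans (map_zero E₁)
    have hTB : T * B ≤ B := by
      rw [Submodule.mul_le]
      rintro _ ⟨t, rfl⟩ _ ⟨b, hb, rfl⟩
      have hb : E₁' b = 0 := hb
      refine ⟨d₁' (Corner.compress h.proj_unitPR t) * b, ?_, ?_⟩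
      · change E₁' _ = 0
        rw [hE₁'.map_mul_left, hb, mul_zero]
      · have h1 := h.mul_corner_eq h.alg.subtype rfl t b
        exact (congrArg ι₁ h1.symm).trans (map_mul ι₁ _ _)
    have hBT : B * T ≤ B := by
      rw [Submodule.mul_le]
      rintro _ ⟨b, hb, rfl⟩ _ ⟨t, rfl⟩
      have hb : E₁' b = 0 := hb
      refine ⟨b * d₁' (Corner.compress h.proj_unitPR t), ?_, ?_⟩
      · change E₁' _ = 0
        rw [hE₁'.map_mul_right, hb, zero_mul]
      · have h1 := h.corner_mul_eq h.alg.subtype rfl t b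
        exact (congrArg ι₁ h1.symm).trans (map_mul ι₁ _ _)
    -- `κ` preserves the letters and their expectations, so it carries words of `C'` to words of
    -- `A`, and limits to limits.
    have hK : K ≤ (T * oddWords ι₁ E₁ ι₂ E₂ * T).topologicalClosure := by
      rintro _ ⟨c, hc, rfl⟩
      have hκc : Continuous κ := (κ.toAlgHom.toLinearMap.mkContinuous 1
        (by simpa using NonUnitalStarAlgHom.norm_apply_le κ)).continuous
      have hcl := h.mem_closure_words hC' hE₀ hE₂ rfl hE₂' hF₂0 hc
      refine map_mem_closure (f := κ) hκc hcl fun x hx => ?_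
      have hT : (imageSubmodule j₁).map κ.toAlgHom.toLinearMap ≤ T :=
        map_imageSubmodule_le κ (StarAlgHom.id ℂ h.alg) hκ₁
      have hW : (oddWords j₁ (E₁ ∘ₗ h.alg.subtype.toAlgHom.toLinearMap) j₂ E₂).map
          κ.toAlgHom.toLinearMap ≤ oddWords ι₁ E₁ ι₂ E₂ :=
        map_oddWords_le κ h.alg.subtype (fun _ => rfl) hκ₁ hκ₂
      have hx' := Submodule.mem_map_of_mem (f := κ.toAlgHom.toLinearMap) hx
      rw [Submodule.map_mul, Submodule.map_mul] at hx'
      exact mul_le_mul' (mul_le_mul' hT hW) hT hx'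
    refine hA.apply_alternating_prod hE₁ hE₂ (imageSubmodule_comp_le ι₁ _) hB hTB hBT hK f hw0 hw
      fun x hx => ?_
    rcases x with x | x
    · exact ⟨x, hwc _ hx, rfl⟩
    · exact ⟨x, hwc _ hx, rfl⟩
  · intro a ha
    -- As `E` is faithful, the GNS condition is needed only at the unit.
    have h1 : E (star (a * 1) * (a * 1)).1 = 0 := by
      rw [← hFE, ha 1]
      exact map_zero E₁
    rw [mul_one] at h1
    exact Subtype.ext (hfA a.1 h1)
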